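/- There are $n$ buyers and $m$ items. Buyer $i$'s type is $t_i=(t_{ij})_{j\in[m]}$; all the $t_{ij}$ are independent, $t_{ij}$ being drawn from a finite set $T_{ij}$ with probability mass function $f_{ij}$; write $T_i=\prod_j T_{ij}$ and $f_i(t_i)=\prod_j f_{ij}(t_{ij})$. Buyer $i$'s valuation $v_i(t_i,S)$, $S\subseteq[m]$, is monotone and subadditive in $S$ and has no externalities ($v_i(t_i,S)$ depends only on $(t_{ij})_{j\in S}$); put $V_i(t_{ij})=v_i(t_i,\{j\})$. Buyers' utilities are quasi-linear. In a rationed sequential posted price mechanism (RSPM) the buyers are visited in a fixed order; buyer $i$ faces nonnegative item prices $p_{ij}$ and takes a favourite among the bundles of at most one remaining item. In an anonymous sequential posted price mechanism with entry fee (ASPE) the buyers are visited in a fixed order and the nonnegative item prices $p_j$ are the same for all buyers; buyer $i$, seeing the set $S$ of remaining items, is asked for an entry fee $\delta_i(S)\ge 0$; she pays it if and only if $\max_{S'\subseteq S}\bigl(v_i(t_i,S')-\sum_{j\in S'}p_j\bigr)\ge\delta_i(S)$, and then takes a favourite bundle $S'\subseteq S$ at the posted prices. Ties between favourite bundles are broken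 arbitrarily. $\mathrm{PostRev}$ and $\mathrm{APostEnRev}$ are the suprema of the expected revenues of RSPMs and of ASPEs. Prices $(\theta_j)_{j\in S}$ are $\alpha$-supporting for $v_i(t_i,\cdot)$ and $S$ if $v_i(t_i,S')\ge\sum_{j\in S'}\theta_j$ for all $S'\subseteq S$ and $\sum_{j\in S}\theta_j\ge v_i(t_i,S)/\alpha$. Let $\alpha\ge1$ and $b\in(0,1)$, and assume that for all $i$, $t_i$, $S$ there are $\alpha$-supporting prices for $v_i(t_i,\cdot)$ and $S$. Let $M^{(\beta)}$ be a (randomised) direct mechanism that never allocates an item to more than one buyer, let $\sigma^{(\beta)}_{iS}(t_i)$ be the interim probability that buyer $i$ with type $t_i$ gets exactly the bundle $S$, and let $\pi^{(\beta)}_{ij}(t_i)=\sum_{S\ni j}\sigma^{(\beta)}_{iS}(t_i)$. Let $\beta_{ij}\ge0$ be numbers such that for all $i,j$ $$\text{(i)}\ \sum_{k\ne i}q_{kj}\le b,\qquad \text{(ii)}\ \sum_{t_i\in T_i}f_i(t_i)\,\pi^{(\beta)}_{ij}(t_i)\le \frac{q_{ij}}{b},$$ where $q_{ij}=\Pr_{t_{ij}}[V_i(t_{ij})\ge\beta_{ij}]$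 or, more generally (ties at $\beta_{ij}$ being resolved by a coin), $q_{ij}$ is any number with $\Pr[V_i(t_{ij})>\beta_{ij}]\le q_{ij}\le\Pr[V_i(t_{ij})\ge\beta_{ij}]$. Define $$c_i=\inf\Bigl\{x\ge0:\ \sum_j\Pr_{t_{ij}}[V_i(t_{ij})\ge\beta_{ij}+x]\le\tfrac12\Bigr\},\qquad \mathcal C_i(t_i)=\{j:\ V_i(t_{ij})<\beta_{ij}+c_i\},$$ $$\mathrm{Core}(M,\beta)=\sum_i\sum_{t_i\in T_i}f_i(t_i)\sum_{S\subseteq[m]}\sigma^{(\beta)}_{iS}(t_i)\,v_i\bigl(t_i,S\cap\mathcal C_i(t_i)\bigr).$$ Then $$\mathrm{Core}(M,\beta)\ \le\ \alpha\left(\frac{4}{b(1-b)}+\frac{24}{1-b}\right)\mathrm{PostRev}+8\alpha\,\mathrm{APostEnRev}.$$ -/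

import Mathlib

open scoped BigOperators NNReal

universe u

noncomputable section

/-- A combinatorial auction with buyers `Fin n` and items `Fin m`. Buyer `i`'s type is
`t i = (t i j)_j`; all the `t i j` are independent, `t i j` having probability mass function `f i j`
on the finite set `T i j`. With type `t`, buyer `i` values the bundle `S` at `v i t S`. -/
structure Auction (n m : ℕ) (T : Fin n → Fin m → Type u) [∀ i j, Fintype (T i j)] where
  f : ∀ i j, T i j → ℝ
  f_nonneg : ∀ i j s, 0 ≤ f i j s
  f_sum : ∀ i j, ∑ s, f i j s = 1
  v : ∀ i : Fin n, (∀ j, T i j) → Finset (Fin m) → ℝ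

/-- `θ` restricted to `S` is a family of `α`-supporting prices for the set function `w` and the
set `S`. -/
def IsSupporting {m : ℕ} (α : ℝ) (w : Finset (Fin m) → ℝ) (S : Finset (Fin m))
    (θ : Fin m → ℝ) : Prop :=
  (∀ S' ⊆ S, ∑ j ∈ S', θ j ≤ w S') ∧ w S / α ≤ ∑ j ∈ S, θ j

/-- A member of the menu `F` that maximises the utility `util`, ties being broken arbitrarily. -/
def favourite {m : ℕ} (F : Finset (Finset (Fin m))) (util : Finset (Fin m) → ℝ) :
    Finset (Fin m) :=
  if h : F.Nonempty then (F.exists_max_image util h).choose else ∅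

/-- The items left after the first `k` buyers have been visited in the order `0, 1, 2, …`, when
buyer `i`, seeing the set `S` of remaining items, takes `take i S`. -/
def remaining {n m : ℕ} (take : Fin n → Finset (Fin m) → Finset (Fin m)) : ℕ → Finset (Fin m)
  | 0 => Finset.univ
  | k + 1 =>
    if h : k < n then remaining take k \ take ⟨k, h⟩ (remaining take k) else remaining take k

namespace Auction

variable {n m : ℕ} {T : Fin n → Fin m → Type u} [∀ i j, Fintype (T i j)] (A : Auction n m T)

/-- No externalities, monotonicity and subadditivity of all the buyers' valuations. -/
structure SubadditiveOverIndependentItems : Prop where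
  no_externalities : ∀ (i : Fin n) (t t' : ∀ j, T i j) (S : Finset (Fin m)),
    (∀ j ∈ S, t j = t' j) → A.v i t S = A.v i t' S
  monotone : ∀ (i : Fin n) (t : ∀ j, T i j) (S S' : Finset (Fin m)),
    S ⊆ S' → A.v i t S ≤ A.v i t S'
  subadditive : ∀ (i : Fin n) (t : ∀ j, T i j) (S S' : Finset (Fin m)),
    A.v i t (S ∪ S') ≤ A.v i t S + A.v i t S'

/-- The value `V_i(t_ij)` of the single item `j`. -/
def V (i : Fin n) (t : ∀ j, T i j) (j : Fin m) : ℝ := A.v i t {j}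

/-- The probability `f_i(t_i)` of a type of buyer `i`. -/
def fType (i : Fin n) (t : ∀ j, T i j) : ℝ := ∏ j, A.f i j (t j)

/-- The probability `f(t)` of a type profile. -/
def fProfile (t : ∀ i j, T i j) : ℝ := ∏ i, A.fType i (t i)

/-- The probability of an event that concerns the type of buyer `i`. -/
def prob (i : Fin n) (P : (∀ j, T i j) → Prop) [DecidablePred P] : ℝ :=
  ∑ t, if P t then A.fType i t else 0

/-- Buyer `i`'s utility for the bundle `S` at item prices `p`. -/
def utility (i : Fin n) (t : ∀ j, T i j) (p : Fin m → ℝ≥0) (S : Finset (Fin m)) : ℝ :=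
  A.v i t S - ∑ j ∈ S, (p j : ℝ)

/-! ### Rationed sequential posted price mechanisms -/

/-- Each buyer takes a favourite among the bundles of at most one remaining item. -/
def rspmTake (p : Fin n → Fin m → ℝ≥0) (t : ∀ i j, T i j) (i : Fin n) (S : Finset (Fin m)) :
    Finset (Fin m) :=
  favourite (S.powerset.filter fun S' => S'.card ≤ 1) (A.utility i (t i) (p i))

/-- Expected revenue of the rationed sequential posted price mechanism in which buyer `i` faces the
price `p i j` for item `j`. -/
def rspmRev (p : Fin n → Fin m → ℝ≥0) : ℝ :=
  ∑ t, A.fProfile t *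
    ∑ i, ∑ j ∈ A.rspmTake p t i (remaining (A.rspmTake p t) i), (p i j : ℝ)

/-- The optimal revenue of a rationed sequential posted price mechanism. -/
def postRev : ℝ := ⨆ p : Fin n → Fin m → ℝ≥0, A.rspmRev p

/-! ### Anonymous sequential posted price mechanisms with entry fee -/

/-- Buyer `i`, seeing the remaining items `S`, agrees to pay the entry fee `δ i S`: the best bundle
in `S` at the posted prices `p` is worth it. -/
def Enters (p : Fin m → ℝ≥0) (δ : Fin n → Finset (Fin m) → ℝ≥0) (t : ∀ i j, T i j) (i : Fin n)
    (S : Finset (Fin m)) : Prop :=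
  (δ i S : ℝ) ≤ A.utility i (t i) p (favourite S.powerset (A.utility i (t i) p))

open Classical in
/-- A buyer who enters takes a favourite bundle, any other buyer takes nothing. -/
def aspeTake (p : Fin m → ℝ≥0) (δ : Fin n → Finset (Fin m) → ℝ≥0) (t : ∀ i j, T i j)
    (i : Fin n) (S : Finset (Fin m)) : Finset (Fin m) :=
  if A.Enters p δ t i S then favourite S.powerset (A.utility i (t i) p) else ∅

open Classical in
/-- What buyer `i` pays when the remaining items are `S`. -/
def aspePay (p : Fin m → ℝ≥0) (δ : Fin n → Finset (Fin m) → ℝ≥0) (t : ∀ i j, T i j)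
    (i : Fin n) (S : Finset (Fin m)) : ℝ :=
  if A.Enters p δ t i S then (δ i S : ℝ) + ∑ j ∈ A.aspeTake p δ t i S, (p j : ℝ) else 0

/-- Expected revenue of the mechanism with anonymous item prices `p` and entry fees `δ`. -/
def aspeRev (p : Fin m → ℝ≥0) (δ : Fin n → Finset (Fin m) → ℝ≥0) : ℝ :=
  ∑ t, A.fProfile t * ∑ i, A.aspePay p δ t i (remaining (A.aspeTake p δ t) i)

/-- The optimal revenue of an anonymous sequential posted price mechanism with entry fee. -/
def aPostEnRev : ℝ :=
  ⨆ x : (Fin m → ℝ≥0) × (Fin n → Finset (Fin m) → ℝ≥0), A.aspeRev x.1 x.2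

/-! The two suprema above are over bounded sets, so they are genuine suprema. -/

lemma favourite_spec {F : Finset (Finset (Fin m))} (h : ∅ ∈ F)
    (util : Finset (Fin m) → ℝ) : util ∅ ≤ util (favourite F util) := by
  have hF : F.Nonempty := ⟨∅, h⟩
  rw [favourite, dif_pos hF]
  exact (F.exists_max_image util hF).choose_spec.2 ∅ h

lemma fProfile_nonneg (t : ∀ i j, T i j) : 0 ≤ A.fProfile t :=
  Finset.prod_nonneg fun _ _ => Finset.prod_nonneg fun _ _ => A.f_nonneg _ _ _

lemma abs_v_le (i : Fin n) (t : ∀ j, T i j) (S : Finset (Fin m)) :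
    |A.v i t S| ≤ ∑ S', |A.v i t S'| :=
  Finset.single_le_sum (f := fun S' => |A.v i t S'|) (fun _ _ => abs_nonneg _)
    (Finset.mem_univ S)

lemma bddAbove_rspmRev : BddAbove (Set.range A.rspmRev) := by
  refine ⟨∑ t, A.fProfile t * ∑ i, 2 * ∑ S, |A.v i (t i) S|, ?_⟩
  rintro _ ⟨p, rfl⟩
  refine Finset.sum_le_sum fun t _ => mul_le_mul_of_nonneg_left
    (Finset.sum_le_sum fun i _ => ?_) (A.fProfile_nonneg t)
  generalize remaining (A.rspmTake p t) i = S
  have h := favourite_spec (F := S.powerset.filter fun S' => S'.card ≤ 1) (by simp)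
    (A.utility i (t i) (p i))
  change _ ≤ A.utility i (t i) (p i) (A.rspmTake p t i S) at h
  simp only [utility, Finset.sum_empty, sub_zero] at h
  have h1 := abs_le.1 (A.abs_v_le i (t i) ∅)
  have h2 := abs_le.1 (A.abs_v_le i (t i) (A.rspmTake p t i S))
  linarith

lemma bddAbove_aspeRev : BddAbove (Set.range fun x : (Fin m → ℝ≥0) ×
    (Fin n → Finset (Fin m) → ℝ≥0) => A.aspeRev x.1 x.2) := by
  refine ⟨∑ t, A.fProfile t * ∑ i, ∑ S, |A.v i (t i) S|, ?_⟩
  rintro _ ⟨⟨p, δ⟩, rfl⟩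
  refine Finset.sum_le_sum fun t _ => mul_le_mul_of_nonneg_left
    (Finset.sum_le_sum fun i _ => ?_) (A.fProfile_nonneg t)
  generalize remaining (A.aspeTake p δ t) i = S
  unfold aspePay
  split_ifs with h
  · rw [aspeTake, if_pos h]
    have h2 := abs_le.1 (A.abs_v_le i (t i) (favourite S.powerset (A.utility i (t i) p)))
    unfold Enters at h
    rw [utility] at h
    linarith
  · positivity

/-! ### The core -/

/-- `c_i`, the least amount by which the thresholds must be raised for the expected number of
items that pass them to be at most `1/2`. -/
def c (β : Fin n → Fin m → ℝ) (i : Fin n) : ℝ :=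
  sInf {x : ℝ | 0 ≤ x ∧ ∑ j, A.prob i (fun t => β i j + x ≤ A.V i t j) ≤ 1 / 2}

/-- `𝒞_i(t_i)`, the items whose own value is below `β_ij + c_i`. -/
def coreItems (β : Fin n → Fin m → ℝ) (i : Fin n) (t : ∀ j, T i j) : Finset (Fin m) :=
  Finset.univ.filter fun j => A.V i t j < β i j + A.c β i

end Auction

/-- The allocation rule of a (randomised) direct mechanism: on the reported profile `t`, the
allocation `a` is chosen with probability `x t a`; here `a j = some i` means that item `j` goes to
buyer `i`, and `a j = none` that `j` is not allocated. -/
structure AllocationRule (n m : ℕ) (T : Fin n → Fin m → Type u) where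
  x : (∀ i j, T i j) → (Fin m → Option (Fin n)) → ℝ
  x_nonneg : ∀ t a, 0 ≤ x t a
  x_sum : ∀ t, ∑ a, x t a = 1

namespace AllocationRule

variable {n m : ℕ} {T : Fin n → Fin m → Type u} [∀ i j, Fintype (T i j)]
  (M : AllocationRule n m T) (A : Auction n m T)

/-- `σ_{iS}(t_i)`: the probability, over the other buyers' types and the coins of the mechanism,
that buyer `i` gets exactly the bundle `S` when reporting `ti`. (The `i`-th coordinate of the
random profile `t` is overwritten by `ti`.) -/
def interim (i : Fin n) (S : Finset (Fin m)) (ti : ∀ j, T i j) : ℝ :=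
  ∑ t : ∀ i j, T i j, A.fProfile t *
    ∑ a : Fin m → Option (Fin n),
      if Finset.univ.filter (fun j => a j = some i) = S
        then M.x (Function.update t i ti) a else 0

/-- `π_ij(t_i)`: the interim probability that buyer `i` gets item `j`. -/
def interimItem (i : Fin n) (j : Fin m) (ti : ∀ j, T i j) : ℝ :=
  ∑ S : Finset (Fin m), if j ∈ S then M.interim A i S ti else 0

/-- `Core`: the expected welfare of the allocation when from every bundle only the items of
`𝒞_i(t_i)` are kept. -/
def core (β : Fin n → Fin m → ℝ) : ℝ :=
  ∑ i, ∑ ti, A.fType i ti *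
    ∑ S : Finset (Fin m), M.interim A i S ti * A.v i ti (S ∩ A.coreItems β i ti)

/-- The two requirements that tie the thresholds `β` to the mechanism. `q i j` is the probability
of the event `V_i(t_ij) ≥ β_ij`. If that value has an atom at `β_ij`, a tie may be resolved by
any coin, so `q i j` may be any number between `Pr[V_i(t_ij) > β_ij]` and `Pr[V_i(t_ij) ≥ β_ij]`;
without tie-breaking, `q i j` is equal to the latter. -/
structure ThresholdRequirement (b : ℝ) (β q : Fin n → Fin m → ℝ) : Prop where
  nonneg : ∀ i j, 0 ≤ β i j
  lower : ∀ i j, A.prob i (fun t => β i j < A.V i t j) ≤ q i j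
  upper : ∀ i j, q i j ≤ A.prob i (fun t => β i j ≤ A.V i t j)
  others : ∀ i j, ∑ k ∈ Finset.univ.erase i, q k j ≤ b
  alloc : ∀ i j, ∑ ti, A.fType i ti * M.interimItem A i j ti ≤ q i j / b

end AllocationRule

end

/-!
Let `v` be the valuations. Supporting prices split the value of the core part of every bundle, up to
the factor `α`, into nonnegative shares of its items, each at most `β_ij + c_i`. Half the expected
total share of an item `j` is taken as its anonymous price `p_j`, so that the core is at most
`2 α ∑ p_j`, and `∑ p_j` has to be bounded by revenues.

Rationed posted prices are controlled by `Auction.mul_sum_price_mul_le_postRev`: prices at which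
every buyer can afford at most `1/2` items in expectation, and every item is affordable to at most
`b` of the buyers other than any given one, sell each item to each buyer with at least the
fraction `(1 - b) / 2` of the probability that this pair would trade in isolation. Ties are
resolved by moving the price slightly up or down at random. Applied to the prices `β_ij + c_i`
this bounds `∑ c_i`; applied to `max β_ij (p_j + τ_i)`, where `τ_i` is chosen such that buyer `i`
can afford half an item, it bounds `∑ τ_i` and the part of the shares that belongs to items worth
more than `p_j + τ_i` (`Auction.expect_share_le`).

The other items are dealt with by an anonymous mechanism with prices `p_j`
(`Auction.sum_sub_price_le_aPostEnRev`). Its entry fee is the median of the utility that a buyer can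
get from the items that exceed their prices by at most `τ_i`. This utility is a subadditive function
of independent items, to which each item contributes at most `τ_i`, so that its expectation is at
most twice its median plus `2 τ_i` (`expectation_le_of_median`); this follows from Talagrand's
inequality for control by two points (`talagrand_two_point`). An item that is sold brings in its
price. An item that is left over was available to all buyers; as its expected share is twice its
price, it adds about its price to their expected utilities, of which the fees recover a quarter.
Hence the revenue is at least a quarter of `∑ p_j`, up to the quantities already bounded.
-/

open Finset

noncomputable section

/-! ### Finite product distributions -/

lemma sum_pi_prod {ι : Type*} [Fintype ι] [DecidableEq ι] {X : ι → Type*} [∀ i, Fintype (X i)]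
    (g : ∀ i, X i → ℝ) : ∑ x : (∀ i, X i), ∏ i, g i (x i) = ∏ i, ∑ s, g i s := by
  rw [Finset.prod_univ_sum, Fintype.piFinset_univ]

lemma sum_pi_prod_eq_one {ι : Type*} [Fintype ι] [DecidableEq ι] {X : ι → Type*}
    [∀ i, Fintype (X i)] {w : ∀ i, X i → ℝ} (h1 : ∀ i, ∑ s, w i s = 1) :
    ∑ x : (∀ i, X i), ∏ i, w i (x i) = 1 := by
  rw [sum_pi_prod]
  simp [h1]

/-- Under a product distribution, redrawing one coordinate independently does not change an
expectation. -/
lemma sum_pi_resample {ι : Type*} [Fintype ι] [DecidableEq ι] {X : ι → Type*}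
    [∀ i, Fintype (X i)] {w : ∀ i, X i → ℝ} (h1 : ∀ i, ∑ s, w i s = 1) (i : ι)
    (F : (∀ i, X i) → ℝ) :
    ∑ x, (∏ k, w k (x k)) * ∑ s, w i s * F (Function.update x i s)
      = ∑ x, (∏ k, w k (x k)) * F x := by
  -- the involution of the pairs `(x, s)` that exchanges `x i` and `s` preserves the weights
  let e : (∀ k, X k) × X i → (∀ k, X k) × X i := fun y => (Function.update y.1 i y.2, y.1 i)
  have he : Function.Involutive e := fun y => by simp [e]
  have hw : ∀ y : (∀ k, X k) × X i,
      (∏ k, w k (y.1 k)) * w i y.2 = (∏ k, w k ((e y).1 k)) * w i (e y).2 := by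
    intro y
    rw [← Finset.mul_prod_erase univ _ (mem_univ i),
      ← Finset.mul_prod_erase univ (fun k => w k ((e y).1 k)) (mem_univ i)]
    have : ∏ k ∈ univ.erase i, w k ((e y).1 k) = ∏ k ∈ univ.erase i, w k (y.1 k) :=
      Finset.prod_congr rfl fun k hk => by simp [e, Function.update_of_ne (ne_of_mem_erase hk)]
    rw [this]
    simp only [e, Function.update_self]
    ring
  calc ∑ x, (∏ k, w k (x k)) * ∑ s, w i s * F (Function.update x i s)
      = ∑ y : (∀ k, X k) × X i, (∏ k, w k (y.1 k)) * w i y.2 * F (e y).1 := by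
        rw [Fintype.sum_prod_type]
        refine Finset.sum_congr rfl fun x _ => ?_
        rw [Finset.mul_sum]
        exact Finset.sum_congr rfl fun s _ => (mul_assoc _ _ _).symm
    _ = ∑ y : (∀ k, X k) × X i, (∏ k, w k ((e y).1 k)) * w i (e y).2 * F (e y).1 := by
        exact Finset.sum_congr rfl fun y _ => by rw [← hw]
    _ = ∑ y : (∀ k, X k) × X i, (∏ k, w k (y.1 k)) * w i y.2 * F y.1 :=
        Equiv.sum_comp he.toPerm fun y : (∀ k, X k) × X i =>
          (∏ k, w k (y.1 k)) * w i y.2 * F y.1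
    _ = ∑ x, (∏ k, w k (x k)) * F x := by
        rw [Fintype.sum_prod_type]
        refine Finset.sum_congr rfl fun x _ => ?_
        calc ∑ s, (∏ k, w k (x k)) * w i s * F x
            = ((∏ k, w k (x k)) * F x) * ∑ s, w i s := by
              rw [Finset.mul_sum]
              exact Finset.sum_congr rfl fun s _ => by ring
          _ = (∏ k, w k (x k)) * F x := by rw [h1, mul_one]

lemma sum_pi_fin_succ {m : ℕ} {T : Fin (m + 1) → Type u} [∀ j, Fintype (T j)]
    (w : ∀ j, T j → ℝ) (F : (∀ j, T j) → ℝ) :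
    ∑ x, (∏ j, w j (x j)) * F x
      = ∑ s, w 0 s * ∑ y : (∀ j : Fin m, T j.succ),
          (∏ j, w j.succ (y j)) * F (Fin.cons s y) := by
  rw [← (Fin.consEquiv T).sum_comp, Fintype.sum_prod_type]
  simp only [Fin.consEquiv, Equiv.coe_fn_mk, Fin.prod_univ_succ, Fin.cons_zero, Fin.cons_succ,
    Finset.mul_sum, mul_assoc]

lemma one_sub_sum_le_prod_one_sub {ι : Type*} (s : Finset ι) (r : ι → ℝ)
    (h0 : ∀ k ∈ s, 0 ≤ r k) (h1 : ∀ k ∈ s, r k ≤ 1) :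
    1 - ∑ k ∈ s, r k ≤ ∏ k ∈ s, (1 - r k) := by
  classical
  induction s using Finset.induction_on with
  | empty => simp
  | insert a s ha ih =>
    rw [Finset.sum_insert ha, Finset.prod_insert ha]
    have ih' := ih (fun k hk => h0 k (mem_insert_of_mem hk)) fun k hk => h1 k (mem_insert_of_mem hk)
    have ha0 := h0 a (mem_insert_self a s)
    have ha1 := h1 a (mem_insert_self a s)
    have hs : 0 ≤ ∑ k ∈ s, r k := Finset.sum_nonneg fun k hk => h0 k (mem_insert_of_mem hk)
    nlinarith [mul_le_mul_of_nonneg_left ih' (sub_nonneg.2 ha1), mul_nonneg ha0 hs]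

/-! ### Quantiles of finite distributions -/

open Filter Topology in
lemma eventually_nhdsGT_le_iff {κ : Type*} [Finite κ] (W : κ → ℝ) (x : ℝ) :
    ∀ᶠ y in 𝓝[>] x, ∀ k, y ≤ W k ↔ x < W k := by
  rw [eventually_all]
  intro k
  rcases lt_or_ge x (W k) with h | h
  · filter_upwards [Ioo_mem_nhdsGT h] with y hy
    exact iff_of_true hy.2.le h
  · filter_upwards [self_mem_nhdsWithin] with y hy
    exact iff_of_false (h.trans_lt hy).not_ge h.not_gt

open Filter Topology in
lemma eventually_nhdsLT_le_iff {κ : Type*} [Finite κ] (W : κ → ℝ) (x : ℝ) :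
    ∀ᶠ y in 𝓝[<] x, ∀ k, y ≤ W k ↔ x ≤ W k := by
  rw [eventually_all]
  intro k
  rcases lt_or_ge (W k) x with h | h
  · filter_upwards [Ioo_mem_nhdsLT h] with y hy
    exact iff_of_false hy.1.not_ge h.not_ge
  · filter_upwards [self_mem_nhdsWithin] with y hy
    exact iff_of_true ((le_of_lt hy).trans h) h

open Filter Topology in
/-- The infimum `τ` of the `x ≥ 0` at which a step function `G` is at most `1/2` is nonnegative;
the right limit `H` of `G` is at most `1/2` there, and `G τ ≥ 1/2` unless `τ = 0`. -/
lemma quantile_spec {G H : ℝ → ℝ} (hr : ∀ x, ∀ᶠ y in 𝓝[>] x, G y = H x)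
    (hl : ∀ x, ∀ᶠ y in 𝓝[<] x, G y = G x) (hG : Antitone G) (hex : ∃ x, 0 ≤ x ∧ G x ≤ 1 / 2) :
    0 ≤ sInf {x : ℝ | 0 ≤ x ∧ G x ≤ 1 / 2} ∧ H (sInf {x : ℝ | 0 ≤ x ∧ G x ≤ 1 / 2}) ≤ 1 / 2 ∧
      (0 < sInf {x : ℝ | 0 ≤ x ∧ G x ≤ 1 / 2} →
        1 / 2 ≤ G (sInf {x : ℝ | 0 ≤ x ∧ G x ≤ 1 / 2})) := by
  set D := {x : ℝ | 0 ≤ x ∧ G x ≤ 1 / 2} with hD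
  have hbdd : BddBelow D := ⟨0, fun x hx => hx.1⟩
  refine ⟨le_csInf hex fun x hx => hx.1, ?_, fun hpos => ?_⟩
  · obtain ⟨y, hy, hy'⟩ := ((hr (sInf D)).and self_mem_nhdsWithin).exists
    obtain ⟨z, hz, hzy⟩ := exists_lt_of_csInf_lt hex hy'
    rw [← hy]
    exact (hG hzy.le).trans hz.2
  · obtain ⟨y, hy, hy'⟩ := ((hl (sInf D)).and (Ioo_mem_nhdsLT hpos)).exists
    rw [← hy]
    by_contra hlt
    exact absurd (csInf_le hbdd (show y ∈ D from ⟨hy'.1.le, (not_le.1 hlt).le⟩)) hy'.2.not_ge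

/-- Numbers `r j` between `h j` and `g j` can be chosen with any sum between the sums of `h` and
of `g`. -/
lemma exists_between_sum_eq {ι : Type*} (s : Finset ι) {g h : ι → ℝ} (hle : ∀ j, h j ≤ g j) {z : ℝ}
    (hz : ∑ j ∈ s, h j ≤ z) (zg : z ≤ ∑ j ∈ s, g j) :
    ∃ r : ι → ℝ, (∀ j, h j ≤ r j) ∧ (∀ j, r j ≤ g j) ∧ ∑ j ∈ s, r j = z := by
  rcases hz.eq_or_lt with rfl | hlt
  · exact ⟨h, fun _ => le_rfl, hle, rfl⟩
  have hpos : 0 < ∑ j ∈ s, g j - ∑ j ∈ s, h j := by linarith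
  set l := (z - ∑ j ∈ s, h j) / (∑ j ∈ s, g j - ∑ j ∈ s, h j) with hl
  have l0 : 0 ≤ l := div_nonneg (by linarith) hpos.le
  have l1 : l ≤ 1 := (div_le_one hpos).2 (by linarith)
  refine ⟨fun j => h j + l * (g j - h j), fun j => ?_, fun j => ?_, ?_⟩
  · nlinarith [hle j]
  · nlinarith [hle j]
  · rw [Finset.sum_add_distrib, ← Finset.mul_sum, Finset.sum_sub_distrib, hl,
      div_mul_cancel₀ _ hpos.ne']
    ring

/-! ### Concentration of subadditive functions of independent items -/

/-- The one-dimensional inequality behind Talagrand's: it suffices that `h ≤ 1 / g` for some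
`g ≥ 1/2` that dominates `a` and `b`, as then `h ≤ 3 - 2 g`. -/
lemma sum_mul_sum_mul_sum_le_one {X : Type*} [Fintype X] {w h a b : X → ℝ}
    (w0 : ∀ s, 0 ≤ w s) (w1 : ∑ s, w s = 1) (a0 : ∀ s, 0 ≤ a s) (b0 : ∀ s, 0 ≤ b s)
    (h0 : ∀ s, 0 ≤ h s)
    (a1 : ∀ s, a s ≤ 1) (b1 : ∀ s, b s ≤ 1) (h2 : ∀ s, h s ≤ 2)
    (ha : ∀ s, h s * a s ≤ 1) (hb : ∀ s, h s * b s ≤ 1) :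
    (∑ s, w s * h s) * (∑ s, w s * a s) * (∑ s, w s * b s) ≤ 1 := by
  let g : X → ℝ := fun s => max (1 / 2) (max (a s) (b s))
  have g2 : ∀ s, 1 / 2 ≤ g s := fun s => le_max_left _ _
  have g1 : ∀ s, g s ≤ 1 := fun s => max_le (by norm_num) (max_le (a1 s) (b1 s))
  have ag : ∀ s, a s ≤ g s := fun s => (le_max_left _ _).trans (le_max_right _ _)
  have bg : ∀ s, b s ≤ g s := fun s => (le_max_right _ _).trans (le_max_right _ _)
  have hg : ∀ s, h s ≤ 3 - 2 * g s := by
    intro s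
    have h1 : h s * g s ≤ 1 := by
      rcases max_choice (1 / 2) (max (a s) (b s)) with e | e
      · simp only [g, e]; linarith [h2 s]
      · rcases max_choice (a s) (b s) with e' | e' <;> simp only [g, e, e']
        exacts [ha s, hb s]
    by_contra hlt
    rw [not_le] at hlt
    nlinarith [mul_nonneg (sub_nonneg.2 (g2 s)) (sub_nonneg.2 (g1 s)),
      mul_lt_mul_of_pos_right hlt (show (0 : ℝ) < g s by linarith [g2 s])]
  set μ := ∑ s, w s * g s with hμ
  have hsum : ∑ s, w s * h s ≤ 3 - 2 * μ := by
    calc ∑ s, w s * h s ≤ ∑ s, w s * (3 - 2 * g s) :=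
          sum_le_sum fun s _ => mul_le_mul_of_nonneg_left (hg s) (w0 s)
      _ = 3 - 2 * μ := by
          simp only [mul_sub, sum_sub_distrib, ← sum_mul, w1, hμ, mul_sum]
          rw [one_mul]
          exact congrArg _ (sum_congr rfl fun s _ => by ring)
  have hsa : ∑ s, w s * a s ≤ μ :=
    sum_le_sum fun s _ => mul_le_mul_of_nonneg_left (ag s) (w0 s)
  have hsb : ∑ s, w s * b s ≤ μ :=
    sum_le_sum fun s _ => mul_le_mul_of_nonneg_left (bg s) (w0 s)
  have pa : 0 ≤ ∑ s, w s * a s := sum_nonneg fun s _ => mul_nonneg (w0 s) (a0 s)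
  have pb : 0 ≤ ∑ s, w s * b s := sum_nonneg fun s _ => mul_nonneg (w0 s) (b0 s)
  have ph : 0 ≤ ∑ s, w s * h s := sum_nonneg fun s _ => mul_nonneg (w0 s) (h0 s)
  calc (∑ s, w s * h s) * (∑ s, w s * a s) * (∑ s, w s * b s)
      ≤ (3 - 2 * μ) * μ * μ := by
        have := ph.trans hsum
        have := pa.trans hsa
        gcongr
    _ ≤ 1 := by nlinarith [mul_nonneg (sq_nonneg (1 - μ)) (show 0 ≤ 2 * μ + 1 by linarith)]

open Classical in
/-- Talagrand's inequality for control by two points: if `φ x` is at most the number of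
coordinates in which `x` differs from both `y` and `z`, for all `y ∈ A` and `z ∈ B`, then
`E[2 ^ φ] ≤ 1 / (P(A) P(B))`. By induction on the number of coordinates: the first coordinate of
`x` is left uncontrolled, or agrees with that of `y`, or with that of `z`. -/
theorem talagrand_two_point {m : ℕ} {T : Fin m → Type u} [∀ j, Fintype (T j)]
    {w : ∀ j, T j → ℝ} (w0 : ∀ j s, 0 ≤ w j s) (w1 : ∀ j, ∑ s, w j s = 1)
    (A B : Set (∀ j, T j)) (φ : (∀ j, T j) → ℕ)
    (hφ : ∀ x, ∀ y ∈ A, ∀ z ∈ B, φ x ≤ #{j | x j ≠ y j ∧ x j ≠ z j}) :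
    (∑ x, (∏ j, w j (x j)) * 2 ^ φ x) * (∑ x, (∏ j, w j (x j)) * A.indicator 1 x)
      * (∑ x, (∏ j, w j (x j)) * B.indicator 1 x) ≤ 1 := by
  induction m with
  | zero =>
    simp only [univ_unique, sum_singleton, univ_eq_empty, prod_empty, one_mul]
    by_cases hA : default ∈ A <;> by_cases hB : default ∈ B
    · have := hφ default _ hA _ hB
      simp only [univ_eq_empty, filter_empty, card_empty, nonpos_iff_eq_zero] at this
      simp [this, hA, hB]
    all_goals simp [hA, hB]
  | succ m ih =>
    simp only [sum_pi_fin_succ w]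
    set pr : (∀ j : Fin m, T j.succ) → ℝ := fun y => ∏ j, w j.succ (y j) with hpr
    have pr0 : ∀ y, 0 ≤ pr y := fun y => prod_nonneg fun j _ => w0 _ _
    set A' : Set (∀ j : Fin m, T j.succ) := {y | ∃ s, Fin.cons s y ∈ A} with hA'
    set B' : Set (∀ j : Fin m, T j.succ) := {y | ∃ s, Fin.cons s y ∈ B} with hB'
    have ind0 : ∀ {Ω : Type u} (C : Set Ω) (y : Ω), (0 : ℝ) ≤ C.indicator 1 y :=
      fun C y => Set.indicator_nonneg (fun _ _ => zero_le_one) y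
    set H : T 0 → ℝ := fun s => ∑ y, pr y * 2 ^ φ (Fin.cons s y) with hH
    set a : T 0 → ℝ := fun s => ∑ y, pr y * A.indicator 1 (Fin.cons s y : ∀ j, T j) with ha
    set b : T 0 → ℝ := fun s => ∑ y, pr y * B.indicator 1 (Fin.cons s y : ∀ j, T j) with hb
    set PA : ℝ := ∑ y, pr y * A'.indicator 1 y with hPA
    set PB : ℝ := ∑ y, pr y * B'.indicator 1 y with hPB
    change (∑ s, w 0 s * H s) * (∑ s, w 0 s * a s) * (∑ s, w 0 s * b s) ≤ 1
    have H0 : ∀ s, 0 ≤ H s := fun s => sum_nonneg fun y _ => mul_nonneg (pr0 y) (by positivity)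
    have a0 : ∀ s, 0 ≤ a s := fun s => sum_nonneg fun y _ => mul_nonneg (pr0 y) (ind0 _ _)
    have b0 : ∀ s, 0 ≤ b s := fun s => sum_nonneg fun y _ => mul_nonneg (pr0 y) (ind0 _ _)
    have PA0 : 0 ≤ PA := sum_nonneg fun y _ => mul_nonneg (pr0 y) (ind0 _ _)
    have PB0 : 0 ≤ PB := sum_nonneg fun y _ => mul_nonneg (pr0 y) (ind0 _ _)
    have aPA : ∀ s, a s ≤ PA := fun s => sum_le_sum fun y _ =>
      mul_le_mul_of_nonneg_left (by
        by_cases h : Fin.cons s y ∈ A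
        · simp [h, show y ∈ A' from ⟨s, h⟩]
        · simpa [h] using ind0 _ _) (pr0 y)
    have bPB : ∀ s, b s ≤ PB := fun s => sum_le_sum fun y _ =>
      mul_le_mul_of_nonneg_left (by
        by_cases h : Fin.cons s y ∈ B
        · simp [h, show y ∈ B' from ⟨s, h⟩]
        · simpa [h] using ind0 _ _) (pr0 y)
    have card_le : ∀ (s s' s'' : T 0) (x y z : ∀ j : Fin m, T j.succ),
        #{j | (Fin.cons s x : ∀ j, T j) j ≠ (Fin.cons s' y : ∀ j, T j) j ∧
          (Fin.cons s x : ∀ j, T j) j ≠ (Fin.cons s'' z : ∀ j, T j) j}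
        = (if s ≠ s' ∧ s ≠ s'' then 1 else 0) + #{j | x j ≠ y j ∧ x j ≠ z j} := by
      intro s s' s'' x y z
      rw [Fin.card_filter_univ_succ']
      simp
    have hA1 : ∀ s, H s * a s * PB ≤ 1 := by
      intro s
      refine ih (fun j => w0 j.succ) (fun j => w1 j.succ) {y | Fin.cons s y ∈ A} B'
        (fun y => φ (Fin.cons s y)) ?_
      rintro x y hy z ⟨s'', hz⟩
      have := hφ (Fin.cons s x) _ hy _ hz
      rw [card_le] at this
      simpa using this
    have hB1 : ∀ s, H s * PA * b s ≤ 1 := by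
      intro s
      refine ih (fun j => w0 j.succ) (fun j => w1 j.succ) A' {y | Fin.cons s y ∈ B}
        (fun y => φ (Fin.cons s y)) ?_
      rintro x y ⟨s', hy⟩ z hz
      have := hφ (Fin.cons s x) _ hy _ hz
      rw [card_le] at this
      simpa using this
    have h2 : ∀ s, H s * PA * PB ≤ 2 := by
      intro s
      have key := ih (fun j => w0 j.succ) (fun j => w1 j.succ) A' B'
        (fun y => φ (Fin.cons s y) - 1) (by
          rintro x y ⟨s', hy⟩ z ⟨s'', hz⟩
          have := hφ (Fin.cons s x) _ hy _ hz
          rw [card_le] at this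
          split_ifs at this <;> omega)
      have hH2 : H s ≤ 2 * ∑ y, pr y * 2 ^ (φ (Fin.cons s y) - 1) := by
        rw [mul_sum]
        refine sum_le_sum fun y _ => ?_
        have : (2 : ℝ) ^ φ (Fin.cons s y) ≤ 2 * 2 ^ (φ (Fin.cons s y) - 1) := by
          rw [← pow_succ']
          exact pow_le_pow_right₀ (by norm_num) (by omega)
        nlinarith [mul_le_mul_of_nonneg_left this (pr0 y)]
      calc H s * PA * PB
          ≤ (2 * ∑ y, pr y * 2 ^ (φ (Fin.cons s y) - 1)) * PA * PB := by gcongr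
        _ = 2 * ((∑ y, pr y * 2 ^ (φ (Fin.cons s y) - 1)) * PA * PB) := by ring
        _ ≤ 2 := by linarith
    rcases PA0.eq_or_lt with hPA0 | hPApos
    · have : ∀ s, a s = 0 := fun s => le_antisymm ((aPA s).trans hPA0.ge) (a0 s)
      simp [this]
    rcases PB0.eq_or_lt with hPB0 | hPBpos
    · have : ∀ s, b s = 0 := fun s => le_antisymm ((bPB s).trans hPB0.ge) (b0 s)
      simp [this]
    have key := sum_mul_sum_mul_sum_le_one (w0 0) (w1 0) (h := fun s => H s * PA * PB)
      (a := fun s => a s / PA) (b := fun s => b s / PB)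
      (fun s => div_nonneg (a0 s) PA0) (fun s => div_nonneg (b0 s) PB0)
      (fun s => mul_nonneg (mul_nonneg (H0 s) PA0) PB0)
      (fun s => (div_le_one hPApos).2 (aPA s)) (fun s => (div_le_one hPBpos).2 (bPB s)) h2
      (fun s => by
        have : H s * PA * PB * (a s / PA) = H s * a s * PB := by field_simp
        rw [this]; exact hA1 s)
      (fun s => by
        have : H s * PA * PB * (b s / PB) = H s * PA * b s := by field_simp
        rw [this]; exact hB1 s)
    refine le_trans (le_of_eq ?_) key
    have e1 : ∑ s, w 0 s * (H s * PA * PB) = (∑ s, w 0 s * H s) * PA * PB := by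
      simp only [sum_mul, mul_assoc]
    have e2 : ∑ s, w 0 s * (a s / PA) = (∑ s, w 0 s * a s) / PA := by
      simp only [sum_div, mul_div_assoc]
    have e3 : ∑ s, w 0 s * (b s / PB) = (∑ s, w 0 s * b s) / PB := by
      simp only [sum_div, mul_div_assoc]
    rw [e1, e2, e3]
    field_simp

open Classical in
/-- A function that is subadditive over independent items, with single items worth at most `c`,
has expectation at most `2 a + 2 c` if it is at most `a` with probability `1/2` or more. If `x`
agrees with one of two points of `{μ ≤ a}` in all but `k` coordinates, then `μ x ≤ 2 a + k c`, and
Talagrand's inequality bounds the expectation of the least such `k` by `2`. -/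
theorem expectation_le_of_median {m : ℕ} {T : Fin m → Type u} [∀ j, Fintype (T j)]
    {w : ∀ j, T j → ℝ} (w0 : ∀ j s, 0 ≤ w j s) (w1 : ∀ j, ∑ s, w j s = 1)
    {μ : (∀ j, T j) → Finset (Fin m) → ℝ}
    (ext : ∀ x y S, (∀ j ∈ S, x j = y j) → μ x S = μ y S)
    (mono : ∀ x S S', S ⊆ S' → μ x S ≤ μ x S')
    (sub : ∀ x S S', μ x (S ∪ S') ≤ μ x S + μ x S')
    (empty : ∀ x, μ x ∅ ≤ 0) {c : ℝ} (c0 : 0 ≤ c) (single : ∀ x j, μ x {j} ≤ c)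
    (S : Finset (Fin m)) {a : ℝ}
    (ha : 1 / 2 ≤ ∑ x, (∏ j, w j (x j)) * {x | μ x S ≤ a}.indicator 1 x) :
    ∑ x, (∏ j, w j (x j)) * μ x S ≤ 2 * a + 2 * c := by
  set A : Set (∀ j, T j) := {x | μ x S ≤ a} with hA
  have hAne : A.Nonempty := by
    by_contra hne
    rw [Set.not_nonempty_iff_eq_empty] at hne
    simp only [hne, Set.indicator_empty, mul_zero, sum_const_zero] at ha
    norm_num at ha
  have pr0 : ∀ x : (∀ j, T j), 0 ≤ ∏ j, w j (x j) := fun x => prod_nonneg fun j _ => w0 _ _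
  have hex : ∀ x : (∀ j, T j), ∃ k, ∃ y ∈ A, ∃ z ∈ A, #{j | x j ≠ y j ∧ x j ≠ z j} = k :=
    fun x => ⟨_, _, hAne.some_mem, _, hAne.some_mem, rfl⟩
  set φ : (∀ j, T j) → ℕ := fun x => Nat.find (hex x) with hφdef
  have hφ : ∀ x, ∀ y ∈ A, ∀ z ∈ A, φ x ≤ #{j | x j ≠ y j ∧ x j ≠ z j} :=
    fun x y hy z hz => Nat.find_le ⟨y, hy, z, hz, rfl⟩
  have cardle : ∀ x (R : Finset (Fin m)), μ x R ≤ c * #R := by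
    intro x R
    induction R using Finset.induction_on with
    | empty => simpa using empty x
    | insert j R hj ih =>
      rw [card_insert_of_notMem hj, insert_eq]
      push_cast
      linarith [sub x {j} R, single x j]
  have hμ : ∀ x, μ x S ≤ 2 * a + c * φ x := by
    intro x
    obtain ⟨y, hy, z, hz, hyz⟩ := Nat.find_spec (hex x)
    set X := S.filter fun j => x j = y j
    set Z := S.filter fun j => x j = z j
    set R := univ.filter fun j => x j ≠ y j ∧ x j ≠ z j with hR
    have hcov : S ⊆ (X ∪ Z) ∪ R := by
      intro j hj
      by_cases h1 : x j = y j
      · simp [X, hj, h1]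
      · by_cases h2 : x j = z j
        · simp [Z, hj, h2]
        · simp [R, h1, h2]
    have h1 : μ x X ≤ a := by
      rw [ext x y X fun j hj => (mem_filter.1 hj).2]
      exact (mono _ _ _ (filter_subset _ _)).trans hy
    have h2 : μ x Z ≤ a := by
      rw [ext x z Z fun j hj => (mem_filter.1 hj).2]
      exact (mono _ _ _ (filter_subset _ _)).trans hz
    have h3 := cardle x R
    have hcard : (#R : ℝ) = φ x := by exact_mod_cast hyz
    rw [hcard] at h3
    linarith [mono x _ _ hcov, sub x (X ∪ Z) R, sub x X Z]
  have key := talagrand_two_point w0 w1 A A φ hφ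
  have hle4 : ∑ x, (∏ j, w j (x j)) * 2 ^ φ x ≤ 4 := by
    have ha' : 1 / 2 ≤ ∑ x, (∏ j, w j (x j)) * A.indicator 1 x := ha
    set p := ∑ x, (∏ j, w j (x j)) * A.indicator (1 : (∀ j, T j) → ℝ) x
    set e := ∑ x, (∏ j, w j (x j)) * (2 : ℝ) ^ φ x
    have e0 : 0 ≤ e := sum_nonneg fun x _ => mul_nonneg (pr0 x) (by positivity)
    nlinarith [mul_le_mul_of_nonneg_left (mul_le_mul ha' ha' (by norm_num) (by linarith)) e0]
  -- at the integers, `2 ^ k` is at least its secant `4 (k - 1)` through `k = 2` and `k = 3`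
  have htan : ∀ k : ℕ, (k : ℝ) ≤ 1 + 2 ^ k / 4 := by
    intro k
    rcases k with _ | _ | k
    · norm_num
    · norm_num
    · have := one_add_mul_le_pow (a := (1 : ℝ)) (by norm_num) k
      rw [show (1 : ℝ) + 1 = 2 by norm_num] at this
      rw [pow_succ, pow_succ]
      push_cast
      linarith
  have sum1 := sum_pi_prod_eq_one w1
  calc ∑ x, (∏ j, w j (x j)) * μ x S
      ≤ ∑ x, (∏ j, w j (x j)) * (2 * a + c * (1 + 2 ^ φ x / 4)) :=
        sum_le_sum fun x _ => mul_le_mul_of_nonneg_left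
          ((hμ x).trans (by nlinarith [mul_le_mul_of_nonneg_left (htan (φ x)) c0])) (pr0 x)
    _ = (2 * a + c) * (∑ x : (∀ j, T j), ∏ j, w j (x j))
          + c / 4 * ∑ x, (∏ j, w j (x j)) * 2 ^ φ x := by
        simp only [mul_sum, ← sum_add_distrib]
        exact sum_congr rfl fun x _ => by ring
    _ ≤ 2 * a + 2 * c := by
        rw [sum1]
        nlinarith [mul_le_mul_of_nonneg_left hle4 c0]

/-! ### Menus and remaining items -/

lemma favourite_mem {m : ℕ} {F : Finset (Finset (Fin m))} (hF : F.Nonempty)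
    (util : Finset (Fin m) → ℝ) : favourite F util ∈ F := by
  rw [favourite, dif_pos hF]
  exact (F.exists_max_image util hF).choose_spec.1

lemma le_favourite {m : ℕ} {F : Finset (Finset (Fin m))} {S : Finset (Fin m)} (hS : S ∈ F)
    (util : Finset (Fin m) → ℝ) : util S ≤ util (favourite F util) := by
  have hF : F.Nonempty := ⟨S, hS⟩
  rw [favourite, dif_pos hF]
  exact (F.exists_max_image util hF).choose_spec.2 S hS

lemma remaining_succ {n m : ℕ} (take : Fin n → Finset (Fin m) → Finset (Fin m)) {k : ℕ}
    (hk : k < n) :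
    remaining take (k + 1) = remaining take k \ take ⟨k, hk⟩ (remaining take k) := by
  rw [remaining, dif_pos hk]

lemma mem_remaining {n m : ℕ} {take : Fin n → Finset (Fin m) → Finset (Fin m)} {j : Fin m} {k : ℕ}
    (hk : k ≤ n) (h : ∀ i : Fin n, (i : ℕ) < k → j ∉ take i (remaining take i)) :
    j ∈ remaining take k := by
  induction k with
  | zero => simp [remaining]
  | succ k ih =>
    rw [remaining_succ take hk, mem_sdiff]
    exact ⟨ih (Nat.le_of_succ_le hk) fun i hi => h i (Nat.lt_succ_of_lt hi),
      h ⟨k, hk⟩ (Nat.lt_succ_self k)⟩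

namespace Auction

variable {n m : ℕ} {T : Fin n → Fin m → Type u} [∀ i j, Fintype (T i j)] {A : Auction n m T}

/-! ### Independence of the types -/

lemma fType_nonneg (A : Auction n m T) (i : Fin n) (t : ∀ j, T i j) : 0 ≤ A.fType i t :=
  prod_nonneg fun _ _ => A.f_nonneg _ _ _

lemma sum_fType (A : Auction n m T) (i : Fin n) : ∑ t, A.fType i t = 1 :=
  sum_pi_prod_eq_one (A.f_sum i)

lemma sum_fProfile (A : Auction n m T) : ∑ t, A.fProfile t = 1 :=
  sum_pi_prod_eq_one A.sum_fType

lemma sum_fProfile_resample (A : Auction n m T) (i : Fin n) (F : (∀ i j, T i j) → ℝ) :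
    ∑ t, A.fProfile t * ∑ s, A.fType i s * F (Function.update t i s) = ∑ t, A.fProfile t * F t :=
  sum_pi_resample A.sum_fType i F

lemma sum_fProfile_mul_prod (A : Auction n m T) (g : ∀ i j, T i j → ℝ) :
    ∑ t : (∀ i j, T i j), A.fProfile t * ∏ i, ∏ j, g i j (t i j)
      = ∏ i, ∏ j, ∑ s, A.f i j s * g i j s := by
  simp only [← sum_pi_prod, fProfile, fType, prod_mul_distrib]

lemma sum_fType_mul_apply (A : Auction n m T) (i : Fin n) (j : Fin m) (g : T i j → ℝ) :
    ∑ t, A.fType i t * g (t j) = ∑ s, A.f i j s * g s := by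
  classical
  let G : ∀ l, T i l → ℝ := fun l s => A.f i l s * if h : l = j then g (h ▸ s) else 1
  have hG : ∀ t : (∀ l, T i l), A.fType i t * g (t j) = ∏ l, G l (t l) := by
    intro t
    simp only [G, prod_mul_distrib]
    rw [prod_eq_single (a := j) (f := fun l => if h : l = j then g (h ▸ t l) else 1)]
    · simp [fType]
    · intro l _ hl
      simp [hl]
    · simp
  simp only [hG]
  rw [sum_pi_prod, prod_eq_single j]
  · simp [G]
  · intro l _ hl
    simp [G, hl, A.f_sum]
  · simp

/-- Without externalities the value of an item depends on that item's coordinate of the type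
only. -/
lemma SubadditiveOverIndependentItems.exists_itemValue (hA : A.SubadditiveOverIndependentItems) :
    ∃ ψ : ∀ i j, T i j → ℝ, ∀ i t j, A.V i t j = ψ i j (t j) := by
  have hne : ∀ i j, Nonempty (T i j) := fun i j => by
    by_contra h
    rw [not_nonempty_iff] at h
    simpa using A.f_sum i j
  refine ⟨fun i j s => A.V i (Function.update (fun l => (hne i l).some) j s) j, fun i t j => ?_⟩
  refine hA.no_externalities _ _ _ _ fun l hl => ?_
  rw [mem_singleton.1 hl, Function.update_self]

/-- `Pr[V_i(t_ij) ≥ x]`. -/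
def probGe (A : Auction n m T) (i : Fin n) (j : Fin m) (x : ℝ) : ℝ :=
  A.prob i fun t => x ≤ A.V i t j

/-- `Pr[V_i(t_ij) > x]`. -/
def probGt (A : Auction n m T) (i : Fin n) (j : Fin m) (x : ℝ) : ℝ :=
  A.prob i fun t => x < A.V i t j

lemma probGe_nonneg (i : Fin n) (j : Fin m) (x : ℝ) : 0 ≤ A.probGe i j x :=
  sum_nonneg fun t _ => by split_ifs <;> simp [A.fType_nonneg]

lemma probGt_nonneg (i : Fin n) (j : Fin m) (x : ℝ) : 0 ≤ A.probGt i j x :=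
  sum_nonneg fun t _ => by split_ifs <;> simp [A.fType_nonneg]

lemma prob_mono {i : Fin n} {P P' : (∀ j, T i j) → Prop} [DecidablePred P] [DecidablePred P']
    (h : ∀ t, P t → P' t) : A.prob i P ≤ A.prob i P' := by
  refine sum_le_sum fun t _ => ?_
  by_cases hP : P t
  · simp [hP, h t hP]
  · rw [if_neg hP]
    split_ifs <;> simp [A.fType_nonneg]

lemma prob_le_one (i : Fin n) (P : (∀ j, T i j) → Prop) [DecidablePred P] : A.prob i P ≤ 1 := by
  rw [← A.sum_fType i]
  refine sum_le_sum fun t _ => ?_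
  split_ifs <;> simp [A.fType_nonneg]

lemma prob_eq_sum_mul (i : Fin n) (P : (∀ j, T i j) → Prop) [DecidablePred P] :
    A.prob i P = ∑ t, A.fType i t * if P t then 1 else 0 := by
  simp [prob]

lemma probGt_le_probGe (i : Fin n) (j : Fin m) (x : ℝ) : A.probGt i j x ≤ A.probGe i j x :=
  prob_mono fun _ h => le_of_lt h

lemma probGe_le_probGt {i : Fin n} {j : Fin m} {x y : ℝ} (h : x < y) :
    A.probGe i j y ≤ A.probGt i j x :=
  prob_mono fun _ h' => h.trans_le h'

lemma probGe_antitone (A : Auction n m T) (i : Fin n) (j : Fin m) : Antitone (A.probGe i j) :=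
  fun _ _ h => prob_mono fun _ h' => h.trans h'

lemma probGt_antitone (A : Auction n m T) (i : Fin n) (j : Fin m) : Antitone (A.probGt i j) :=
  fun _ _ h => prob_mono fun _ h' => h.trans_lt h'

lemma probGe_eq_sum {ψ : ∀ i j, T i j → ℝ} (hψ : ∀ i t j, A.V i t j = ψ i j (t j))
    (i : Fin n) (j : Fin m) (x : ℝ) :
    A.probGe i j x = ∑ s, A.f i j s * if x ≤ ψ i j s then 1 else 0 := by
  rw [probGe, prob_eq_sum_mul, ← A.sum_fType_mul_apply]
  simp only [hψ]

lemma probGt_eq_sum {ψ : ∀ i j, T i j → ℝ} (hψ : ∀ i t j, A.V i t j = ψ i j (t j))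
    (i : Fin n) (j : Fin m) (x : ℝ) :
    A.probGt i j x = ∑ s, A.f i j s * if x < ψ i j s then 1 else 0 := by
  rw [probGt, prob_eq_sum_mul, ← A.sum_fType_mul_apply]
  simp only [hψ]

/-! ### Revenue of rationed sequential posted prices -/

/-- Buyer `i` buys item `j` if `j` is the only item worth its price to `i`, and `i` is the only
buyer to whom `j` is worth its price. -/
lemma rspmTake_eq_singleton (h0 : ∀ i t, A.v i t ∅ = 0) {p : Fin n → Fin m → ℝ≥0}
    {t : ∀ i j, T i j} {i : Fin n} {j : Fin m} (hij : (p i j : ℝ) < A.V i (t i) j)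
    (hrow : ∀ l, l ≠ j → A.V i (t i) l < p i l) (hcol : ∀ k, k ≠ i → A.V k (t k) j < p k j) :
    A.rspmTake p t i (remaining (A.rspmTake p t) i) = {j} := by
  have hmem : ∀ k (S : Finset (Fin m)), A.rspmTake p t k S ⊆ S ∧ #(A.rspmTake p t k S) ≤ 1 := by
    intro k S
    have := favourite_mem (F := S.powerset.filter fun S' => S'.card ≤ 1) ⟨∅, by simp⟩
      (A.utility k (t k) (p k))
    simpa [rspmTake] using this
  have hmax : ∀ k (S S' : Finset (Fin m)), S' ⊆ S → #S' ≤ 1 →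
      A.utility k (t k) (p k) S' ≤ A.utility k (t k) (p k) (A.rspmTake p t k S) :=
    fun k S S' h h' => le_favourite (by simp [h, h']) _
  have hsing : ∀ k l, A.utility k (t k) (p k) {l} = A.V k (t k) l - p k l := by
    simp [utility, V]
  have hemp : ∀ k, A.utility k (t k) (p k) ∅ = 0 := by simp [utility, h0]
  have hrem : j ∈ remaining (A.rspmTake p t) i := by
    refine mem_remaining i.2.le fun k hk hj => ?_
    obtain ⟨_, h1⟩ := hmem k (remaining (A.rspmTake p t) k)
    have h2 := hmax k (remaining (A.rspmTake p t) k) ∅ (by simp) (by simp)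
    have h3 : A.rspmTake p t k (remaining (A.rspmTake p t) k) = {j} := by
      obtain ⟨l, hl⟩ := card_eq_one.1 (le_antisymm h1 (card_pos.2 ⟨j, hj⟩))
      rw [hl, mem_singleton] at hj
      rw [hl, hj]
    rw [h3, hemp, hsing] at h2
    linarith [hcol k (Fin.ne_of_lt hk)]
  generalize remaining (A.rspmTake p t) i = S at hrem ⊢
  obtain ⟨_, h1⟩ := hmem i S
  have h2 := hmax i S {j} (by simpa using hrem) (by simp)
  rw [hsing] at h2
  rcases Nat.le_one_iff_eq_zero_or_eq_one.1 h1 with h | h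
  · rw [card_eq_zero] at h
    rw [h, hemp] at h2
    linarith
  · obtain ⟨l, hl⟩ := card_eq_one.1 h
    rw [hl] at h2 ⊢
    by_contra hne
    have hlj : l ≠ j := fun e => hne (by rw [e])
    rw [hsing] at h2
    linarith [hrow l hlj]

/-- The factor that buyer `k` and item `l`, at price `x`, contribute to a lower bound for the
revenue from selling item `j` to buyer `i`: the expected revenue for `(i, j)` itself, the
probability of not competing for the pairs in the same row or column. -/
def saleFactor (A : Auction n m T) (i : Fin n) (j : Fin m) (k : Fin n) (l : Fin m) (x : ℝ) : ℝ :=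
  if k = i ∧ l = j then x * A.probGt k l x
  else if k = i ∨ l = j then 1 - A.probGe k l x else 1

lemma sum_prod_saleFactor_le_rspmRev (hA : A.SubadditiveOverIndependentItems)
    (h0 : ∀ i t, A.v i t ∅ = 0) (p : Fin n → Fin m → ℝ≥0) :
    ∑ i, ∑ j, ∏ k, ∏ l, A.saleFactor i j k l (p k l) ≤ A.rspmRev p := by
  obtain ⟨ψ, hψ⟩ := hA.exists_itemValue
  let g : Fin n → Fin m → ∀ k l, T k l → ℝ := fun i j k l s =>
    if k = i ∧ l = j then (p k l : ℝ) * if (p k l : ℝ) < ψ k l s then 1 else 0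
    else if k = i ∨ l = j then 1 - (if (p k l : ℝ) ≤ ψ k l s then 1 else 0) else 1
  have hg : ∀ i j k l, A.saleFactor i j k l (p k l) = ∑ s, A.f k l s * g i j k l s := by
    intro i j k l
    simp only [saleFactor, g, probGt_eq_sum hψ, probGe_eq_sum hψ]
    split_ifs
    · rw [mul_sum]
      exact sum_congr rfl fun s _ => by ring
    · simp only [mul_sub, sum_sub_distrib, mul_one, A.f_sum]
    · simp only [mul_one, A.f_sum]
  simp only [hg, ← sum_fProfile_mul_prod, rspmRev]
  simp only [sum_comm (t := (univ : Finset (∀ i j, T i j))), ← mul_sum]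
  refine sum_le_sum fun t _ => mul_le_mul_of_nonneg_left ?_ (A.fProfile_nonneg t)
  refine sum_le_sum fun i _ => ?_
  have hsum : ∑ j ∈ A.rspmTake p t i (remaining (A.rspmTake p t) i), (p i j : ℝ)
      = ∑ j, if j ∈ A.rspmTake p t i (remaining (A.rspmTake p t) i) then (p i j : ℝ) else 0 := by
    rw [sum_ite_mem, univ_inter]
  rw [hsum]
  refine sum_le_sum fun j _ => ?_
  have hg0 : ∀ k l, 0 ≤ g i j k l (t k l) := by
    intro k l
    simp only [g]
    split_ifs <;> simp
  have hg1 : ∀ k l, g i j k l (t k l) ≤ if k = i ∧ l = j then (p i j : ℝ) else 1 := by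
    intro k l
    simp only [g]
    split_ifs with h <;> simp
    · rw [h.1, h.2]
  split_ifs with hmem
  · calc ∏ k, ∏ l, g i j k l (t k l)
        ≤ ∏ k, ∏ l, (if k = i ∧ l = j then (p i j : ℝ) else 1) :=
          prod_le_prod (fun k _ => prod_nonneg fun l _ => hg0 k l) fun k _ =>
            prod_le_prod (fun l _ => hg0 k l) fun l _ => hg1 k l
      _ = p i j := by
          rw [prod_eq_single i, prod_eq_single j] <;> simp +contextual
  · refine le_of_eq ?_
    by_contra hne
    have hne' : ∀ k l, g i j k l (t k l) ≠ 0 := fun k l h =>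
      hne (prod_eq_zero (mem_univ k) (prod_eq_zero (mem_univ l) h))
    refine hmem ?_
    rw [rspmTake_eq_singleton (j := j) h0 ?_ ?_ ?_]
    · exact mem_singleton_self j
    · have := hne' i j
      by_contra hlt
      simp [g, ← hψ, hlt] at this
    · intro l hl
      have := hne' i l
      by_contra hlt
      simp [g, ← hψ, hl, not_lt.1 hlt] at this
    · intro k hk
      have := hne' k j
      by_contra hlt
      simp [g, ← hψ, hk, not_lt.1 hlt] at this

lemma prod_prod_cross (i : Fin n) (j : Fin m) (x : ℝ) (r : Fin n → Fin m → ℝ) :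
    ∏ k, ∏ l, (if k = i ∧ l = j then x else if k = i ∨ l = j then 1 - r k l else 1)
      = x * ((∏ l ∈ univ.erase j, (1 - r i l)) * ∏ k ∈ univ.erase i, (1 - r k j)) := by
  rw [← mul_prod_erase univ _ (mem_univ i), ← mul_prod_erase univ _ (mem_univ j), mul_assoc]
  congr 1
  · simp
  congr 1
  · exact prod_congr rfl fun l hl => by simp [ne_of_mem_erase hl]
  · refine prod_congr rfl fun k hk => ?_
    rw [prod_eq_single j] <;> simp +contextual [ne_of_mem_erase hk]

lemma rspmRev_le_postRev (p : Fin n → Fin m → ℝ≥0) : A.rspmRev p ≤ A.postRev :=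
  le_ciSup A.bddAbove_rspmRev p

lemma postRev_nonneg (A : Auction n m T) : 0 ≤ A.postRev := by
  refine le_trans (le_of_eq ?_) (rspmRev_le_postRev fun _ _ => 0)
  simp [rspmRev]

/-- Posting independently random prices, `lo k l` with probability `κ k l` and `hi k l` otherwise,
does not beat the best deterministic prices. -/
lemma sum_prod_saleFactor_le_postRev (hA : A.SubadditiveOverIndependentItems)
    (h0 : ∀ i t, A.v i t ∅ = 0) (lo hi : Fin n → Fin m → ℝ≥0) {κ : Fin n → Fin m → ℝ}
    (hκ0 : ∀ k l, 0 ≤ κ k l) (hκ1 : ∀ k l, κ k l ≤ 1) :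
    ∑ i, ∑ j, ∏ k, ∏ l, (κ k l * A.saleFactor i j k l (lo k l)
      + (1 - κ k l) * A.saleFactor i j k l (hi k l)) ≤ A.postRev := by
  let w : Fin n → Fin m → Bool → ℝ := fun k l c => if c then κ k l else 1 - κ k l
  let P : (∀ (_ : Fin n) (_ : Fin m), Bool) → Fin n → Fin m → ℝ≥0 :=
    fun c k l => if c k l then lo k l else hi k l
  have w0 : ∀ c : (∀ (_ : Fin n) (_ : Fin m), Bool), 0 ≤ ∏ k, ∏ l, w k l (c k l) := fun c =>
    prod_nonneg fun k _ => prod_nonneg fun l _ => by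
      simp only [w]
      split_ifs
      exacts [hκ0 k l, sub_nonneg.2 (hκ1 k l)]
  have w1 : ∑ c : (∀ (_ : Fin n) (_ : Fin m), Bool), ∏ k, ∏ l, w k l (c k l) = 1 := by
    rw [sum_pi_prod fun k (c : Fin m → Bool) => ∏ l, w k l (c l)]
    refine prod_eq_one fun k _ => ?_
    rw [sum_pi_prod fun l c => w k l c]
    simp [w]
  have hexp : ∀ i j, ∏ k, ∏ l, (κ k l * A.saleFactor i j k l (lo k l)
      + (1 - κ k l) * A.saleFactor i j k l (hi k l))
      = ∑ c : (∀ (_ : Fin n) (_ : Fin m), Bool), (∏ k, ∏ l, w k l (c k l)) *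
          ∏ k, ∏ l, A.saleFactor i j k l (P c k l) := by
    intro i j
    let G : Fin n → Fin m → Bool → ℝ := fun k l c =>
      w k l c * A.saleFactor i j k l ((if c then lo k l else hi k l : ℝ≥0))
    have : ∀ k l, κ k l * A.saleFactor i j k l (lo k l)
        + (1 - κ k l) * A.saleFactor i j k l (hi k l) = ∑ c, G k l c := by
      intro k l
      simp [G, w]
    simp only [this, ← sum_pi_prod]
    simp only [G, P, prod_mul_distrib]
  simp only [hexp, sum_comm (t := (univ : Finset (∀ (_ : Fin n) (_ : Fin m), Bool))), ← mul_sum]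
  calc _ ≤ ∑ c : (∀ (_ : Fin n) (_ : Fin m), Bool), (∏ k, ∏ l, w k l (c k l)) * A.postRev :=
        sum_le_sum fun c _ => mul_le_mul_of_nonneg_left
          ((sum_prod_saleFactor_le_rspmRev hA h0 (P c)).trans (rspmRev_le_postRev _)) (w0 c)
    _ = A.postRev := by rw [← sum_mul, w1, one_mul]

/-- The two prices `ξ ± ε` (or `0` and `ε`, if `ξ = 0`), for `ε` so small that no other value than
`ξ` is within `ε` of `ξ`, sell with the probabilities `Pr[V ≥ ξ]` and `Pr[V > ξ]`. -/
lemma exists_prices {ψ : ∀ i j, T i j → ℝ} (hψ : ∀ i t j, A.V i t j = ψ i j (t j)) {k : Fin n}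
    {l : Fin m} {ξ ε : ℝ} (hξ : 0 ≤ ξ) (ε0 : 0 < ε) (hεξ : ξ ≠ 0 → ε < ξ)
    (hε : ∀ s, ψ k l s ≠ ξ → ε < |ψ k l s - ξ|) :
    ∃ lo hi : ℝ≥0, A.probGe k l lo = A.probGe k l ξ ∧
      (ξ - ε) * A.probGe k l ξ ≤ lo * A.probGt k l lo ∧
      A.probGe k l hi = A.probGt k l ξ ∧
      (ξ - ε) * A.probGt k l ξ ≤ hi * A.probGt k l hi := by
  have hgap : ∀ t, A.V k t l ≠ ξ → ε < |A.V k t l - ξ| := fun t => by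
    rw [hψ]
    exact hε (t l)
  have hge : ∀ t, ξ ≤ A.V k t l ∨ A.V k t l < ξ - ε := by
    intro t
    rcases le_or_gt ξ (A.V k t l) with h | h
    · exact .inl h
    · have := hgap t h.ne
      rw [abs_of_neg (sub_neg.2 h)] at this
      exact .inr (by linarith)
  have hgt : ∀ t, A.V k t l ≤ ξ ∨ ξ + ε < A.V k t l := by
    intro t
    rcases le_or_gt (A.V k t l) ξ with h | h
    · exact .inl h
    · have := hgap t h.ne'
      rw [abs_of_pos (sub_pos.2 h)] at this
      exact .inr (by linarith)
  obtain ⟨lo, hlo, hlo'⟩ : ∃ lo : ℝ≥0, A.probGe k l lo = A.probGe k l ξ ∧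
      (ξ - ε) * A.probGe k l ξ ≤ lo * A.probGt k l lo := by
    rcases hξ.eq_or_lt with h | h
    · refine ⟨0, by rw [← h]; rfl, ?_⟩
      rw [← h, NNReal.coe_zero, zero_mul]
      nlinarith [A.probGe_nonneg k l 0]
    · have hle : 0 ≤ ξ - ε := by linarith [hεξ h.ne']
      have h1 : A.probGe k l ξ ≤ A.probGt k l (ξ - ε) := probGe_le_probGt (by linarith)
      refine ⟨(ξ - ε).toNNReal, ?_, ?_⟩ <;> rw [Real.coe_toNNReal _ hle]
      · exact le_antisymm (prob_mono fun t ht => (hge t).resolve_right (not_lt.2 ht))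
          (probGe_antitone A k l (by linarith))
      · exact mul_le_mul_of_nonneg_left h1 hle
  refine ⟨lo, (ξ + ε).toNNReal, hlo, hlo', ?_⟩
  rw [Real.coe_toNNReal _ (by positivity)]
  refine ⟨le_antisymm (probGe_le_probGt (by linarith))
    (prob_mono fun t ht => ((hgt t).resolve_left (not_le.2 ht)).le), ?_⟩
  have h1 : A.probGt k l ξ ≤ A.probGt k l (ξ + ε) :=
    prob_mono fun t ht => (hgt t).resolve_left (not_le.2 ht)
  nlinarith [A.probGt_nonneg k l ξ, A.probGt_nonneg k l (ξ + ε)]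

open Filter Topology in
/-- If at the prices `ξ`, with ties resolved by coins, every buyer can afford at most `1/2` items
in expectation, and every item is affordable to at most `b` of the buyers other than any given
one, then the prices raise `(1 - b) / 2` of the revenue that they would raise if sales could not
conflict. -/
theorem mul_sum_price_mul_le_postRev (hA : A.SubadditiveOverIndependentItems)
    (h0 : ∀ i t, A.v i t ∅ = 0) {b : ℝ} (hb1 : b < 1) {ξ r : Fin n → Fin m → ℝ}
    (hξ : ∀ i j, 0 ≤ ξ i j) (hlow : ∀ i j, A.probGt i j (ξ i j) ≤ r i j)
    (hupp : ∀ i j, r i j ≤ A.probGe i j (ξ i j)) (hrow : ∀ i, ∑ j, r i j ≤ 1 / 2)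
    (hcol : ∀ i j, ∑ k ∈ univ.erase i, r k j ≤ b) :
    (1 - b) / 2 * ∑ i, ∑ j, ξ i j * r i j ≤ A.postRev := by
  obtain ⟨ψ, hψ⟩ := hA.exists_itemValue
  have r0 : ∀ i j, 0 ≤ r i j := fun i j => (A.probGt_nonneg i j _).trans (hlow i j)
  have r1 : ∀ i j, r i j ≤ 1 := fun i j => (hupp i j).trans (prob_le_one _ _)
  -- `κ` is the probability with which a tie is resolved in favour of buying
  have hκ : ∀ i j, ∃ κ : ℝ, 0 ≤ κ ∧ κ ≤ 1 ∧
      κ * A.probGe i j (ξ i j) + (1 - κ) * A.probGt i j (ξ i j) = r i j := by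
    intro i j
    rcases (probGt_le_probGe (A := A) i j (ξ i j)).eq_or_lt with h | h
    · exact ⟨0, le_rfl, zero_le_one, by linarith [hlow i j, hupp i j]⟩
    · have hpos := sub_pos.2 h
      refine ⟨(r i j - A.probGt i j (ξ i j)) / (A.probGe i j (ξ i j) - A.probGt i j (ξ i j)),
        div_nonneg (sub_nonneg.2 (hlow i j)) hpos.le, (div_le_one hpos).2 (by linarith [hupp i j]),
        ?_⟩
      field_simp
      ring
  choose κ κ0 κ1 hκr using hκ
  set F : Fin n → Fin m → ℝ := fun i j =>
    (∏ l ∈ univ.erase j, (1 - r i l)) * ∏ k ∈ univ.erase i, (1 - r k j) with hF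
  have hF0 : ∀ i j, 0 ≤ F i j := fun i j =>
    mul_nonneg (prod_nonneg fun l _ => sub_nonneg.2 (r1 i l))
      (prod_nonneg fun k _ => sub_nonneg.2 (r1 k j))
  have hF1 : ∀ i j, F i j ≤ 1 := fun i j =>
    mul_le_one₀ (prod_le_one (fun l _ => sub_nonneg.2 (r1 i l)) fun l _ => by linarith [r0 i l])
      (prod_nonneg fun k _ => sub_nonneg.2 (r1 k j))
      (prod_le_one (fun k _ => sub_nonneg.2 (r1 k j)) fun k _ => by linarith [r0 k j])
  have hFb : ∀ i j, (1 - b) / 2 ≤ F i j := by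
    intro i j
    have h1 : 1 / 2 ≤ ∏ l ∈ univ.erase j, (1 - r i l) := by
      refine le_trans ?_ (one_sub_sum_le_prod_one_sub _ _ (fun l _ => r0 i l) fun l _ => r1 i l)
      have := sum_le_sum_of_subset_of_nonneg (erase_subset j univ) fun l _ _ => r0 i l
      linarith [hrow i]
    have h2 : 1 - b ≤ ∏ k ∈ univ.erase i, (1 - r k j) := by
      refine le_trans ?_ (one_sub_sum_le_prod_one_sub _ _ (fun k _ => r0 k j) fun k _ => r1 k j)
      linarith [hcol i j]
    have := mul_le_mul h1 h2 (by linarith) (by linarith)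
    linarith
  have hε : ∀ᶠ ε in 𝓝[>] (0 : ℝ), 0 < ε ∧ (∀ i j, ξ i j ≠ 0 → ε < ξ i j) ∧
      ∀ i j s, ψ i j s ≠ ξ i j → ε < |ψ i j s - ξ i j| := by
    have small : ∀ x : ℝ, 0 < x → ∀ᶠ ε in 𝓝[>] (0 : ℝ), ε < x := fun x hx =>
      by
      filter_upwards [Ioo_mem_nhdsGT hx] with ε h using h.2
    refine (eventually_mem_nhdsWithin).and (Eventually.and ?_ ?_)
    · simp only [eventually_all]
      exact fun i j h => small _ (lt_of_le_of_ne (hξ i j) h.symm)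
    · simp only [eventually_all]
      exact fun i j s h => small _ (abs_pos.2 (sub_ne_zero.2 h))
  have key : ∀ᶠ ε in 𝓝[>] (0 : ℝ),
      (1 - b) / 2 * ∑ i, ∑ j, ξ i j * r i j - ε * (n * m) ≤ A.postRev := by
    filter_upwards [hε] with ε hε
    obtain ⟨ε0, hεξ, hεψ⟩ := hε
    choose lo hi hlo hlo' hhi hhi' using fun k l =>
      exists_prices hψ (hξ k l) ε0 (hεξ k l) (hεψ k l)
    refine le_trans ?_ (sum_prod_saleFactor_le_postRev hA h0 lo hi κ0 κ1)
    have hcross : ∀ i j, ∏ k, ∏ l, (κ k l * A.saleFactor i j k l (lo k l)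
        + (1 - κ k l) * A.saleFactor i j k l (hi k l))
        = (κ i j * (lo i j * A.probGt i j (lo i j))
            + (1 - κ i j) * (hi i j * A.probGt i j (hi i j))) * F i j := by
      intro i j
      rw [hF, ← prod_prod_cross]
      refine prod_congr rfl fun k _ => prod_congr rfl fun l _ => ?_
      simp only [saleFactor]
      split_ifs with h h'
      · rw [h.1, h.2]
      · rw [hlo, hhi, ← hκr]
        ring
      · ring
    have hterm : ∀ i j, (1 - b) / 2 * (ξ i j * r i j) - ε
        ≤ ∏ k, ∏ l, (κ k l * A.saleFactor i j k l (lo k l)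
          + (1 - κ k l) * A.saleFactor i j k l (hi k l)) := by
      intro i j
      rw [hcross]
      have h1 : (ξ i j - ε) * r i j ≤ κ i j * (lo i j * A.probGt i j (lo i j))
            + (1 - κ i j) * (hi i j * A.probGt i j (hi i j)) := by
        rw [← hκr]
        nlinarith [mul_le_mul_of_nonneg_left (hlo' i j) (κ0 i j),
          mul_le_mul_of_nonneg_left (hhi' i j) (sub_nonneg.2 (κ1 i j))]
      have h2 := mul_le_mul_of_nonneg_right h1 (hF0 i j)
      have h3 := mul_le_mul_of_nonneg_left (hFb i j) (mul_nonneg (hξ i j) (r0 i j))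
      have h4 : r i j * F i j ≤ 1 := mul_le_one₀ (r1 i j) (hF0 i j) (hF1 i j)
      nlinarith [mul_le_mul_of_nonneg_left h4 ε0.le]
    refine le_trans (le_of_eq ?_) (sum_le_sum fun i _ => sum_le_sum fun j _ => hterm i j)
    simp only [sum_sub_distrib, ← mul_sum, sum_const, card_univ, Fintype.card_fin, nsmul_eq_mul]
    ring
  have hlim : Tendsto (fun ε : ℝ => (1 - b) / 2 * ∑ i, ∑ j, ξ i j * r i j - ε * (n * m)) (𝓝[>] 0)
      (𝓝 ((1 - b) / 2 * ∑ i, ∑ j, ξ i j * r i j - 0 * (n * m))) :=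
    (Continuous.tendsto (by fun_prop) 0).mono_left nhdsWithin_le_nhds
  have := le_of_tendsto hlim key
  linarith

end Auction

/-! ### Interim allocation probabilities -/

namespace AllocationRule

variable {n m : ℕ} {T : Fin n → Fin m → Type u} [∀ i j, Fintype (T i j)]
  {M : AllocationRule n m T} {A : Auction n m T}

lemma interim_nonneg (i : Fin n) (S : Finset (Fin m)) (ti : ∀ j, T i j) :
    0 ≤ M.interim A i S ti :=
  sum_nonneg fun t _ => mul_nonneg (A.fProfile_nonneg t) <| sum_nonneg fun a _ => by
    split_ifs
    exacts [M.x_nonneg _ _, le_rfl]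

lemma sum_interim (i : Fin n) (ti : ∀ j, T i j) : ∑ S, M.interim A i S ti = 1 := by
  simp only [interim]
  rw [sum_comm]
  simp only [← mul_sum]
  refine Eq.trans (sum_congr rfl fun t _ => ?_) A.sum_fProfile
  rw [sum_comm]
  simp [M.x_sum]

/-- No item is allocated more than once in expectation. -/
lemma sum_interimItem_le_one (M : AllocationRule n m T) (A : Auction n m T) (j : Fin m) :
    ∑ i, ∑ ti, A.fType i ti * M.interimItem A i j ti ≤ 1 := by
  have h1 : ∀ i ti, M.interimItem A i j ti = ∑ t, A.fProfile t *
      ∑ a : Fin m → Option (Fin n),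
        if a j = some i then M.x (Function.update t i ti) a else 0 := by
    intro i ti
    simp only [interimItem, interim]
    rw [← sum_filter, sum_comm]
    refine sum_congr rfl fun t _ => ?_
    rw [← mul_sum, sum_comm]
    refine congrArg _ (sum_congr rfl fun a _ => ?_)
    simp [sum_ite_eq]
  have h2 : ∀ i, ∑ ti, A.fType i ti * M.interimItem A i j ti = ∑ t, A.fProfile t *
      ∑ a : Fin m → Option (Fin n), if a j = some i then M.x t a else 0 := by
    intro i
    rw [← A.sum_fProfile_resample i]
    simp only [h1, mul_sum]
    rw [sum_comm]
    exact sum_congr rfl fun t _ => sum_congr rfl fun ti _ => sum_congr rfl fun a _ => by ring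
  simp only [h2]
  rw [sum_comm]
  simp only [← mul_sum]
  rw [← A.sum_fProfile]
  refine sum_le_sum fun t _ => mul_le_of_le_one_right (A.fProfile_nonneg t) ?_
  rw [sum_comm, ← M.x_sum t]
  refine sum_le_sum fun a _ => ?_
  rcases a j with _ | k
  · simp [M.x_nonneg]
  · simp

end AllocationRule

namespace Auction

variable {n m : ℕ} {T : Fin n → Fin m → Type u} [∀ i j, Fintype (T i j)] {A : Auction n m T}

/-! ### Raising thresholds until half an item is sold -/

/-- The amount `τ` by which the thresholds `d` must be raised for the sum of the probabilities
`Pr[V_i(t_ij) ≥ d_j + τ]`, capped at `u_j`, to be at most `1/2`. -/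
def excess (A : Auction n m T) (i : Fin n) (d u : Fin m → ℝ) : ℝ :=
  sInf {x : ℝ | 0 ≤ x ∧ ∑ j, min (u j) (A.probGe i j (d j + x)) ≤ 1 / 2}

lemma c_eq_excess (A : Auction n m T) (β : Fin n → Fin m → ℝ) (i : Fin n) :
    A.c β i = A.excess i (β i) fun _ => 1 := by
  have : ∀ j x, min 1 (A.probGe i j (β i j + x)) = A.prob i fun t => β i j + x ≤ A.V i t j :=
    fun j x => min_eq_right (prob_le_one _ _)
  simp only [c, excess, this]

open Filter Topology in
lemma excess_spec (A : Auction n m T) (i : Fin n) (d u : Fin m → ℝ) :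
    0 ≤ A.excess i d u ∧ ∑ j, min (u j) (A.probGt i j (d j + A.excess i d u)) ≤ 1 / 2 ∧
      (0 < A.excess i d u →
        1 / 2 ≤ ∑ j, min (u j) (A.probGe i j (d j + A.excess i d u))) := by
  refine quantile_spec (G := fun x => ∑ j, min (u j) (A.probGe i j (d j + x)))
    (H := fun x => ∑ j, min (u j) (A.probGt i j (d j + x))) (fun x => ?_) (fun x => ?_)
    (fun x y hxy => sum_le_sum fun j _ => min_le_min le_rfl
      (probGe_antitone A i j (add_le_add_right hxy _))) ?_
  · filter_upwards [eventually_nhdsGT_le_iff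
      (fun k : (∀ j, T i j) × Fin m => A.V i k.1 k.2 - d k.2) x] with y hy
    refine sum_congr rfl fun j _ => congrArg _ (le_antisymm ?_ ?_) <;>
      refine prob_mono fun t ht => ?_ <;> have := hy (t, j) <;> simp only at this
    · linarith [this.1 (by linarith)]
    · linarith [this.2 (by linarith)]
  · filter_upwards [eventually_nhdsLT_le_iff
      (fun k : (∀ j, T i j) × Fin m => A.V i k.1 k.2 - d k.2) x] with y hy
    refine sum_congr rfl fun j _ => congrArg _ (le_antisymm ?_ ?_) <;>
      refine prob_mono fun t ht => ?_ <;> have := hy (t, j) <;> simp only at this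
    · linarith [this.1 (by linarith)]
    · linarith [this.2 (by linarith)]
  · -- beyond all the values nothing is sold
    obtain ⟨x, hx⟩ := (Set.finite_range
      fun k : (∀ j, T i j) × Fin m => A.V i k.1 k.2 - d k.2).bddAbove
    refine ⟨max x 0 + 1, by positivity, ?_⟩
    have hz : ∀ j, A.probGe i j (d j + (max x 0 + 1)) = 0 := by
      refine fun j => sum_eq_zero fun t _ => if_neg fun ht => ?_
      have : A.V i t j - d j ≤ x := hx ⟨(t, j), rfl⟩
      linarith [le_max_left x 0]
    refine (sum_nonpos fun j _ => ?_).trans (by norm_num)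
    rw [hz]
    exact min_le_right _ _

/-- Selling rates at the thresholds raised by the excess `τ`: with ties suitably resolved they add
up to `1/2`, unless `τ = 0`, where all ties are resolved against selling. -/
lemma exists_rates (A : Auction n m T) (i : Fin n) (d u : Fin m → ℝ) :
    ∃ r : Fin m → ℝ, (∀ j, min (u j) (A.probGt i j (d j + A.excess i d u)) ≤ r j) ∧
      (∀ j, r j ≤ min (u j) (A.probGe i j (d j + A.excess i d u))) ∧ ∑ j, r j ≤ 1 / 2 ∧
      A.excess i d u ≤ 2 * (A.excess i d u * ∑ j, r j) ∧
      (A.excess i d u = 0 → ∀ j, r j = min (u j) (A.probGt i j (d j))) := by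
  obtain ⟨hτ, hH, hG⟩ := A.excess_spec i d u
  have hle : ∀ j, min (u j) (A.probGt i j (d j + A.excess i d u))
      ≤ min (u j) (A.probGe i j (d j + A.excess i d u)) :=
    fun j => min_le_min le_rfl (probGt_le_probGe _ _ _)
  rcases hτ.eq_or_lt with h | h
  · exact ⟨_, fun j => le_rfl, hle, hH, by simp [← h], fun h' j => by rw [h', add_zero]⟩
  · obtain ⟨r, h1, h2, h3⟩ := exists_between_sum_eq univ hle hH (hG h)
    exact ⟨r, h1, h2, h3.le, by rw [h3]; linarith, fun h' => absurd h' h.ne'⟩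

/-- The price `β_ij + c_i` brings in at least `c_i / 2` from every buyer `i`. -/
lemma mul_sum_c_le_postRev (hA : A.SubadditiveOverIndependentItems) (h0 : ∀ i t, A.v i t ∅ = 0)
    {b : ℝ} (hb1 : b < 1) {β q : Fin n → Fin m → ℝ} (hβ : ∀ i j, 0 ≤ β i j)
    (hq : ∀ i j, A.probGt i j (β i j) ≤ q i j)
    (hcol : ∀ i j, ∑ k ∈ univ.erase i, q k j ≤ b) :
    (1 - b) * ∑ i, A.c β i ≤ 4 * A.postRev := by
  simp only [c_eq_excess]
  choose r h1 h2 h3 h4 h5 using fun i => A.exists_rates i (β i) fun _ => 1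
  set c := fun i => A.excess i (β i) fun _ => 1 with hc
  have c0 : ∀ i, 0 ≤ c i := fun i => (A.excess_spec i _ _).1
  have r0 : ∀ i j, 0 ≤ r i j := fun i j =>
    (le_min zero_le_one (probGt_nonneg _ _ _)).trans (h1 i j)
  have hrq : ∀ i j, r i j ≤ q i j := by
    intro i j
    rcases (c0 i).eq_or_lt with h | h
    · rw [h5 i h.symm]
      exact (min_le_right _ _).trans (hq i j)
    · exact ((h2 i j).trans (min_le_right _ _)).trans
        ((probGe_le_probGt (by simpa using h)).trans (hq i j))
  have key := mul_sum_price_mul_le_postRev hA h0 hb1 (ξ := fun i j => β i j + c i) (r := r)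
    (fun i j => add_nonneg (hβ i j) (c0 i))
    (fun i j => (le_min (prob_le_one _ _) le_rfl).trans (h1 i j))
    (fun i j => (h2 i j).trans (min_le_right _ _)) h3
    (fun i j => (sum_le_sum fun k _ => hrq k j).trans (hcol i j))
  have hsum : ∑ i, c i ≤ 2 * ∑ i, ∑ j, (β i j + c i) * r i j := by
    rw [mul_sum]
    refine sum_le_sum fun i _ => (h4 i).trans ?_
    rw [mul_sum]
    have : ∑ j, c i * r i j ≤ ∑ j, (β i j + c i) * r i j :=
      sum_le_sum fun j _ => mul_le_mul_of_nonneg_right (by linarith [hβ i j]) (r0 i j)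
    linarith
  nlinarith [mul_le_mul_of_nonneg_left hsum (sub_nonneg.2 hb1.le)]

/-- A median of a nonnegative function of buyer `i`'s type. -/
lemma exists_median (A : Auction n m T) (i : Fin n) {g : (∀ j, T i j) → ℝ} (hg : ∀ t, 0 ≤ g t) :
    ∃ δ : ℝ≥0, 1 / 2 ≤ ∑ t, A.fType i t * {t | g t ≤ δ}.indicator 1 t ∧
      1 / 2 ≤ ∑ t, A.fType i t * {t | (δ : ℝ) ≤ g t}.indicator 1 t := by
  have hdec : ∀ x, ∑ t, A.fType i t * {t | g t ≤ x}.indicator 1 t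
      = 1 - ∑ t, A.fType i t * {t | x < g t}.indicator 1 t := by
    intro x
    rw [eq_sub_iff_add_eq, ← sum_add_distrib, ← A.sum_fType i]
    refine sum_congr rfl fun t _ => ?_
    rcases le_or_gt (g t) x with h | h
    · simp [h, h.not_gt]
    · simp [h, h.not_ge]
  have hspec := quantile_spec
    (G := fun x => ∑ t, A.fType i t * {t | x ≤ g t}.indicator 1 t)
    (H := fun x => ∑ t, A.fType i t * {t | x < g t}.indicator 1 t) ?_ ?_ ?_ ?_
  · generalize sInf {x : ℝ | 0 ≤ x ∧ ∑ t, A.fType i t * {t | x ≤ g t}.indicator 1 t ≤ 1 / 2} = z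
      at hspec
    obtain ⟨h1, h2, h3⟩ := hspec
    refine ⟨z.toNNReal, ?_, ?_⟩ <;> rw [Real.coe_toNNReal _ h1]
    · rw [hdec]
      linarith
    · rcases h1.eq_or_lt with h | h
      · rw [← h]
        have : {t | 0 ≤ g t} = Set.univ := Set.eq_univ_of_forall hg
        simp only [this, Set.indicator_univ, Pi.one_apply, mul_one, A.sum_fType]
        norm_num
      · exact h3 h
  · intro x
    filter_upwards [eventually_nhdsGT_le_iff g x] with y hy
    simp only [hy]
  · intro x
    filter_upwards [eventually_nhdsLT_le_iff g x] with y hy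
    simp only [hy]
  · intro x y hxy
    exact sum_le_sum fun t _ => mul_le_mul_of_nonneg_left (Set.indicator_le_indicator_of_subset
      (fun t (ht : y ≤ g t) => hxy.trans ht) (fun _ => zero_le_one) t) (A.fType_nonneg i t)
  · obtain ⟨x, hx⟩ := (Set.finite_range g).bddAbove
    refine ⟨max x 0 + 1, by positivity, ?_⟩
    have : {t | max x 0 + 1 ≤ g t} = ∅ := by
      refine Set.eq_empty_of_forall_notMem fun t ht => ?_
      have h1 : g t ≤ x := hx ⟨t, rfl⟩
      have h2 : max x 0 + 1 ≤ g t := ht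
      linarith [le_max_left x 0]
    simp [this]

end Auction

namespace AllocationRule

variable {n m : ℕ} {T : Fin n → Fin m → Type u} [∀ i j, Fintype (T i j)]
  {M : AllocationRule n m T} {A : Auction n m T}

/-! ### Expectations over a buyer's type and bundle -/

/-- The expectation of a function of buyer `i`'s type and of the bundle that she gets. -/
def expect (M : AllocationRule n m T) (A : Auction n m T) (i : Fin n)
    (φ : (∀ j, T i j) → Finset (Fin m) → ℝ) : ℝ :=
  ∑ ti, A.fType i ti * ∑ S, M.interim A i S ti * φ ti S

lemma expect_mono {i : Fin n} {φ φ' : (∀ j, T i j) → Finset (Fin m) → ℝ}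
    (h : ∀ ti S, φ ti S ≤ φ' ti S) : M.expect A i φ ≤ M.expect A i φ' :=
  sum_le_sum fun ti _ => mul_le_mul_of_nonneg_left
    (sum_le_sum fun S _ => mul_le_mul_of_nonneg_left (h ti S) (interim_nonneg i S ti))
    (A.fType_nonneg i ti)

lemma expect_nonneg {i : Fin n} {φ : (∀ j, T i j) → Finset (Fin m) → ℝ}
    (h : ∀ ti S, 0 ≤ φ ti S) : 0 ≤ M.expect A i φ :=
  sum_nonneg fun ti _ => mul_nonneg (A.fType_nonneg i ti) <|
    sum_nonneg fun S _ => mul_nonneg (interim_nonneg i S ti) (h ti S)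

lemma expect_const_bundle (i : Fin n) (g : (∀ j, T i j) → ℝ) :
    M.expect A i (fun ti _ => g ti) = ∑ ti, A.fType i ti * g ti := by
  simp only [expect, ← sum_mul, sum_interim, one_mul]

lemma expect_mul_left (i : Fin n) (c : ℝ) (φ : (∀ j, T i j) → Finset (Fin m) → ℝ) :
    M.expect A i (fun ti S => c * φ ti S) = c * M.expect A i φ := by
  simp only [expect, mul_sum]
  exact sum_congr rfl fun ti _ => sum_congr rfl fun S _ => by ring

lemma expect_add (i : Fin n) (φ φ' : (∀ j, T i j) → Finset (Fin m) → ℝ) :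
    M.expect A i (fun ti S => φ ti S + φ' ti S) = M.expect A i φ + M.expect A i φ' := by
  simp only [expect, mul_add, sum_add_distrib]

lemma expect_sub (i : Fin n) (φ φ' : (∀ j, T i j) → Finset (Fin m) → ℝ) :
    M.expect A i (fun ti S => φ ti S - φ' ti S) = M.expect A i φ - M.expect A i φ' := by
  simp only [expect, mul_sub, sum_sub_distrib]

lemma expect_sum {ι : Type*} (i : Fin n) (s : Finset ι)
    (φ : ι → (∀ j, T i j) → Finset (Fin m) → ℝ) :
    M.expect A i (fun ti S => ∑ k ∈ s, φ k ti S) = ∑ k ∈ s, M.expect A i (φ k) := by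
  simp only [expect, mul_sum]
  exact (sum_congr rfl fun _ _ => sum_comm).trans sum_comm

lemma expect_ite_mem (i : Fin n) (j : Fin m) :
    M.expect A i (fun _ S => if j ∈ S then 1 else 0)
      = ∑ ti, A.fType i ti * M.interimItem A i j ti := by
  simp [expect, interimItem]

end AllocationRule

namespace Auction

variable {n m : ℕ} {T : Fin n → Fin m → Type u} [∀ i j, Fintype (T i j)] {A : Auction n m T}

/-! ### The surplus that the entry fee extracts -/

/-- The items whose own value exceeds the price by at most `τ`. -/
def cheapItems (A : Auction n m T) (p : Fin m → ℝ≥0) (τ : ℝ) (i : Fin n) (t : ∀ j, T i j) :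
    Finset (Fin m) :=
  univ.filter fun j => A.V i t j ≤ p j + τ

/-- The greatest utility that buyer `i` can get at the prices `p` from those items of `U` whose own
value exceeds the price by at most `τ`. -/
def surplus (A : Auction n m T) (p : Fin m → ℝ≥0) (τ : ℝ) (i : Fin n) (t : ∀ j, T i j)
    (U : Finset (Fin m)) : ℝ :=
  A.utility i t p (favourite (U ∩ A.cheapItems p τ i t).powerset (A.utility i t p))

section surplus

variable {p : Fin m → ℝ≥0} {τ : ℝ} {i : Fin n} {t : ∀ j, T i j}

lemma utility_le_surplus {S U : Finset (Fin m)} (h : S ⊆ U ∩ A.cheapItems p τ i t) :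
    A.utility i t p S ≤ A.surplus p τ i t U :=
  le_favourite (mem_powerset.2 h) _

lemma exists_surplus_eq (p : Fin m → ℝ≥0) (τ : ℝ) (i : Fin n) (t : ∀ j, T i j)
    (U : Finset (Fin m)) :
    ∃ S ⊆ U ∩ A.cheapItems p τ i t, A.surplus p τ i t U = A.utility i t p S :=
  ⟨_, mem_powerset.1 (favourite_mem ⟨∅, empty_mem_powerset _⟩ _), rfl⟩

lemma surplus_nonneg (h0 : ∀ i t, A.v i t ∅ = 0) (U : Finset (Fin m)) :
    0 ≤ A.surplus p τ i t U :=
  le_trans (by simp [utility, h0]) (utility_le_surplus (empty_subset _))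

lemma surplus_le_utility (U : Finset (Fin m)) :
    A.surplus p τ i t U ≤ A.utility i t p (favourite U.powerset (A.utility i t p)) := by
  obtain ⟨S, hS, h⟩ := exists_surplus_eq (A := A) p τ i t U
  rw [h]
  exact le_favourite (mem_powerset.2 (hS.trans inter_subset_left)) _

lemma surplus_mono {U U' : Finset (Fin m)} (hU : U ⊆ U') :
    A.surplus p τ i t U ≤ A.surplus p τ i t U' := by
  obtain ⟨S, hS, h⟩ := exists_surplus_eq (A := A) p τ i t U
  rw [h]
  exact utility_le_surplus (hS.trans (inter_subset_inter_right hU))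

lemma surplus_union_le (hA : A.SubadditiveOverIndependentItems) (U U' : Finset (Fin m)) :
    A.surplus p τ i t (U ∪ U') ≤ A.surplus p τ i t U + A.surplus p τ i t U' := by
  obtain ⟨S, hS, h⟩ := exists_surplus_eq (A := A) p τ i t (U ∪ U')
  rw [h]
  have h1 : S ∩ U ⊆ U ∩ A.cheapItems p τ i t := fun j hj => by
    have := hS (mem_inter.1 hj).1
    simp only [mem_inter] at hj this ⊢
    exact ⟨hj.2, this.2⟩
  have h2 : S \ U ⊆ U' ∩ A.cheapItems p τ i t := fun j hj => by
    have := hS (mem_sdiff.1 hj).1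
    simp only [mem_inter, mem_union, mem_sdiff] at hj this ⊢
    exact ⟨this.1.resolve_left hj.2, this.2⟩
  refine le_trans ?_ (add_le_add (utility_le_surplus h1) (utility_le_surplus h2))
  have h3 := hA.subadditive i t (S ∩ U) (S \ U)
  rw [union_comm, sdiff_union_inter] at h3
  have h4 := sum_inter_add_sum_sdiff S U fun j => (p j : ℝ)
  simp only [utility]
  linarith

lemma surplus_empty_le (h0 : ∀ i t, A.v i t ∅ = 0) : A.surplus p τ i t ∅ ≤ 0 := by
  obtain ⟨S, hS, h⟩ := exists_surplus_eq (A := A) p τ i t ∅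
  rw [h, subset_empty.1 (hS.trans inter_subset_left)]
  simp [utility, h0]

lemma surplus_singleton_le (h0 : ∀ i t, A.v i t ∅ = 0) (hτ : 0 ≤ τ) (j : Fin m) :
    A.surplus p τ i t {j} ≤ τ := by
  obtain ⟨S, hS, h⟩ := exists_surplus_eq (A := A) p τ i t {j}
  rw [h]
  rcases subset_singleton_iff.1 (hS.trans inter_subset_left) with rfl | rfl
  · simpa [utility, h0] using hτ
  · have : A.V i t j ≤ p j + τ := by
      have := (mem_inter.1 (hS (mem_singleton_self j))).2
      simpa [cheapItems] using this
    simp only [utility, sum_singleton]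
    rw [V] at this
    linarith

lemma surplus_congr (hA : A.SubadditiveOverIndependentItems) {t' : ∀ j, T i j}
    {U : Finset (Fin m)} (h : ∀ j ∈ U, t j = t' j) :
    A.surplus p τ i t U = A.surplus p τ i t' U := by
  have key : ∀ t t' : (∀ j, T i j), (∀ j ∈ U, t j = t' j) →
      A.surplus p τ i t U ≤ A.surplus p τ i t' U := by
    intro t t' h
    obtain ⟨S, hS, e⟩ := exists_surplus_eq (A := A) p τ i t U
    have hSU := hS.trans inter_subset_left
    have hu : A.utility i t p S = A.utility i t' p S := by
      rw [utility, utility, hA.no_externalities i t t' S fun j hj => h j (hSU hj)]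
    rw [e, hu]
    refine utility_le_surplus fun j hj => mem_inter.2 ⟨hSU hj, ?_⟩
    have h1 := (mem_inter.1 (hS hj)).2
    have h2 : A.V i t j = A.V i t' j := hA.no_externalities i t t' {j} fun l hl => by
      rw [mem_singleton.1 hl]
      exact h j (hSU hj)
    simpa [cheapItems, h2] using h1
  exact le_antisymm (key t t' h) (key t' t fun j hj => (h j hj).symm)

end surplus

/-! ### Revenue of anonymous prices with entry fees -/

lemma aspeTake_subset (p : Fin m → ℝ≥0) (δ : Fin n → Finset (Fin m) → ℝ≥0) (t : ∀ i j, T i j)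
    (i : Fin n) (S : Finset (Fin m)) : A.aspeTake p δ t i S ⊆ S := by
  rw [aspeTake]
  split_ifs
  · exact mem_powerset.1 (favourite_mem ⟨∅, empty_mem_powerset _⟩ _)
  · exact empty_subset _

end Auction

lemma remaining_antitone {n m : ℕ} (take : Fin n → Finset (Fin m) → Finset (Fin m)) :
    Antitone (remaining take) := by
  refine antitone_nat_of_succ_le fun k => ?_
  rw [remaining]
  split_ifs
  exacts [sdiff_subset, le_rfl]

lemma remaining_congr {n m : ℕ} {take take' : Fin n → Finset (Fin m) → Finset (Fin m)} {k : ℕ}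
    (h : ∀ i : Fin n, (i : ℕ) < k → take i = take' i) : remaining take k = remaining take' k := by
  induction k with
  | zero => rfl
  | succ k ih =>
    simp only [remaining, ih fun i hi => h i (Nat.lt_succ_of_lt hi)]
    split_ifs with hk
    · rw [h ⟨k, hk⟩ (Nat.lt_succ_self k)]
    · rfl

/-- Every item is either taken by exactly one buyer or remains in the end. -/
lemma sum_sum_take {n m : ℕ} {take : Fin n → Finset (Fin m) → Finset (Fin m)}
    (h : ∀ i S, take i S ⊆ S) (p : Fin m → ℝ) :
    ∑ i, ∑ j ∈ take i (remaining take i), p j = ∑ j, p j - ∑ j ∈ remaining take n, p j := by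
  have hstep : ∀ i : Fin n, ∑ j ∈ take i (remaining take i), p j
      = ∑ j ∈ remaining take i, p j - ∑ j ∈ remaining take (i + 1), p j := by
    intro i
    rw [remaining_succ take i.2, sum_sdiff_eq_sub (h _ _)]
    simp
  simp only [hstep]
  rw [Fin.sum_univ_eq_sum_range
    fun k => ∑ j ∈ remaining take k, p j - ∑ j ∈ remaining take (k + 1), p j, sum_range_sub']
  rfl

namespace Auction

variable {n m : ℕ} {T : Fin n → Fin m → Type u} [∀ i j, Fintype (T i j)] {A : Auction n m T}

open Classical in
lemma aspePay_eq (p : Fin m → ℝ≥0) (δ : Fin n → Finset (Fin m) → ℝ≥0) (t : ∀ i j, T i j)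
    (i : Fin n) (S : Finset (Fin m)) :
    A.aspePay p δ t i S
      = (if A.Enters p δ t i S then (δ i S : ℝ) else 0)
        + ∑ j ∈ A.aspeTake p δ t i S, (p j : ℝ) := by
  rw [aspePay]
  split_ifs with h
  · rfl
  · simp [aspeTake, h]

lemma enters_update (p : Fin m → ℝ≥0) (δ : Fin n → Finset (Fin m) → ℝ≥0) (t : ∀ i j, T i j)
    (i : Fin n) (s : ∀ j, T i j) (S : Finset (Fin m)) :
    A.Enters p δ (Function.update t i s) i S ↔
      (δ i S : ℝ) ≤ A.utility i s p (favourite S.powerset (A.utility i s p)) := by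
  rw [Enters, Function.update_self]

/-- The items that buyer `i` finds do not depend on her type. -/
lemma remaining_aspeTake_update (p : Fin m → ℝ≥0) (δ : Fin n → Finset (Fin m) → ℝ≥0)
    (t : ∀ i j, T i j) (i : Fin n) (s : ∀ j, T i j) :
    remaining (A.aspeTake p δ (Function.update t i s)) i = remaining (A.aspeTake p δ t) i := by
  refine remaining_congr fun k hk => ?_
  have hne : k ≠ i := Fin.ne_of_lt hk
  funext S
  simp only [aspeTake, Enters, Function.update_of_ne hne]
  congr

lemma aspeRev_le_aPostEnRev (p : Fin m → ℝ≥0) (δ : Fin n → Finset (Fin m) → ℝ≥0) :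
    A.aspeRev p δ ≤ A.aPostEnRev :=
  le_ciSup A.bddAbove_aspeRev (p, δ)

open Classical in
/-- If buyer `i` accepts the fee for any set of items with probability at least `1/2`, the mechanism
collects half of all the fees it asks for, besides the prices of the items sold. -/
lemma le_aspeRev {p : Fin m → ℝ≥0} {δ : Fin n → Finset (Fin m) → ℝ≥0}
    (hδ : ∀ i U, 1 / 2 ≤ ∑ t, A.fType i t *
      {t | (δ i U : ℝ) ≤ A.utility i t p (favourite U.powerset (A.utility i t p))}.indicator 1 t) :
    ∑ t, A.fProfile t * (∑ i, (δ i (remaining (A.aspeTake p δ t) i) : ℝ) / 2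
      + (∑ j, (p j : ℝ) - ∑ j ∈ remaining (A.aspeTake p δ t) n, (p j : ℝ))) ≤ A.aspeRev p δ := by
  have h1 : A.aspeRev p δ = ∑ i, ∑ t, A.fProfile t *
        (if A.Enters p δ t i (remaining (A.aspeTake p δ t) i)
          then (δ i (remaining (A.aspeTake p δ t) i) : ℝ) else 0)
      + ∑ t, A.fProfile t *
        (∑ j, (p j : ℝ) - ∑ j ∈ remaining (A.aspeTake p δ t) n, (p j : ℝ)) := by
    rw [sum_comm, ← sum_add_distrib, aspeRev]
    refine sum_congr rfl fun t _ => ?_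
    rw [← mul_sum, ← mul_add, ← sum_sum_take (A.aspeTake_subset p δ t), ← sum_add_distrib]
    simp only [aspePay_eq]
  rw [h1]
  simp only [mul_add, sum_add_distrib, mul_sum]
  refine add_le_add ?_ le_rfl
  rw [sum_comm]
  refine sum_le_sum fun i _ => ?_
  rw [← A.sum_fProfile_resample i fun t => if A.Enters p δ t i (remaining (A.aspeTake p δ t) i)
          then (δ i (remaining (A.aspeTake p δ t) i) : ℝ) else 0]
  refine sum_le_sum fun t _ => mul_le_mul_of_nonneg_left ?_ (A.fProfile_nonneg t)
  simp only [remaining_aspeTake_update, enters_update]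
  set U := remaining (A.aspeTake p δ t) i
  calc (δ i U : ℝ) / 2 ≤ (δ i U : ℝ) * ∑ t, A.fType i t *
      {t | (δ i U : ℝ) ≤ A.utility i t p (favourite U.powerset (A.utility i t p))}.indicator 1 t :=
        by
        have := mul_le_mul_of_nonneg_left (hδ i U) (δ i U).coe_nonneg
        linarith
    _ = _ := by
        rw [mul_sum]
        refine sum_congr rfl fun s _ => ?_
        by_cases h : (δ i U : ℝ) ≤ A.utility i s p (favourite U.powerset (A.utility i s p))
        · simp [h, mul_comm]
        · simp [h]

/-- Anonymous prices `p` with median surpluses as entry fees: `W j` is the expected share of item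
`j` in the value of the bundles of `M`, as far as the items of the bundle exceed their prices by at
most `τ i`. A sold item brings in its price `p j ≥ W j - p j`. If `j` is left over, every buyer
could have had it, and it contributes `W j - p j` to the sum of the expected surpluses. -/
theorem sum_sub_price_le_aPostEnRev (hA : A.SubadditiveOverIndependentItems)
    (h0 : ∀ i t, A.v i t ∅ = 0) (M : AllocationRule n m T) (p : Fin m → ℝ≥0) {τ : Fin n → ℝ}
    (hτ : ∀ i, 0 ≤ τ i) {γ : ∀ i, (∀ j, T i j) → Finset (Fin m) → Fin m → ℝ}
    (γS : ∀ i t S, ∀ j ∉ S, γ i t S j = 0) (γv : ∀ i t S S', ∑ j ∈ S', γ i t S j ≤ A.v i t S')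
    {W : Fin m → ℝ} (hW : ∀ j, W j = ∑ i, M.expect A i fun t S =>
      if j ∈ A.cheapItems p (τ i) i t then γ i t S j else 0)
    (hWp : ∀ j, W j ≤ 2 * p j) :
    ∑ j, (W j - p j) ≤ 4 * A.aPostEnRev + 2 * ∑ i, τ i := by
  choose δ hδ1 hδ2 using fun i U => A.exists_median i (g := fun t => A.surplus p (τ i) i t U)
    fun t => surplus_nonneg h0 U
  have hmean : ∀ i U, ∑ t, A.fType i t * A.surplus p (τ i) i t U ≤ 2 * δ i U + 2 * τ i := by
    intro i U
    exact expectation_le_of_median (A.f_nonneg i) (A.f_sum i)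
      (μ := fun t U => A.surplus p (τ i) i t U) (fun t t' U h => surplus_congr hA h)
      (fun t U U' h => surplus_mono h) (fun t U U' => surplus_union_le hA U U')
      (fun t => surplus_empty_le h0) (hτ i) (fun t j => surplus_singleton_le h0 (hτ i) j) U
      (hδ1 i U)
  have hsurplus : ∀ U : Finset (Fin m), ∑ j ∈ U, (W j - p j)
      ≤ ∑ i, ∑ t, A.fType i t * A.surplus p (τ i) i t U := by
    intro U
    have hpt : ∀ i t S, ∑ j ∈ U, ((if j ∈ A.cheapItems p (τ i) i t then γ i t S j else 0)
        - p j * if j ∈ S then 1 else 0) ≤ A.surplus p (τ i) i t U := by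
      intro i t S
      set Y := A.cheapItems p (τ i) i t with hY
      refine le_trans ?_ (utility_le_surplus (S := U ∩ S ∩ Y)
        (inter_subset_inter_right inter_subset_left))
      rw [utility, sum_sub_distrib]
      refine sub_le_sub ?_ ?_
      · refine le_trans (le_of_eq ?_) (γv i t S (U ∩ S ∩ Y))
        rw [← sum_filter]
        symm
        refine sum_subset (fun j hj => ?_) fun j hj hj' => γS i t S j ?_
        · simp only [mem_inter, mem_filter] at hj ⊢
          exact ⟨hj.1.1, hj.2⟩
        · simp only [mem_inter, mem_filter] at hj hj'
          tauto
      · simp only [mul_ite, mul_one, mul_zero]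
        rw [← sum_filter]
        refine sum_le_sum_of_subset_of_nonneg (fun j hj => ?_) fun j _ _ => (p j).coe_nonneg
        simp only [mem_inter, mem_filter] at hj ⊢
        exact hj.1
    calc ∑ j ∈ U, (W j - p j)
        ≤ ∑ j ∈ U, ∑ i, (M.expect A i (fun t S =>
            if j ∈ A.cheapItems p (τ i) i t then γ i t S j else 0)
            - p j * M.expect A i fun _ S => if j ∈ S then 1 else 0) := by
          refine sum_le_sum fun j _ => ?_
          rw [sum_sub_distrib, ← mul_sum, hW]
          simp only [AllocationRule.expect_ite_mem]
          have := mul_le_mul_of_nonneg_left (M.sum_interimItem_le_one A j) (p j).coe_nonneg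
          linarith
      _ = ∑ i, M.expect A i fun t S => ∑ j ∈ U,
            ((if j ∈ A.cheapItems p (τ i) i t then γ i t S j else 0)
              - p j * if j ∈ S then 1 else 0) := by
          rw [sum_comm]
          simp only [AllocationRule.expect_sum, AllocationRule.expect_sub,
            AllocationRule.expect_mul_left]
      _ ≤ ∑ i, M.expect A i fun t _ => A.surplus p (τ i) i t U :=
          sum_le_sum fun i _ => AllocationRule.expect_mono fun t S => hpt i t S
      _ = _ := by simp only [AllocationRule.expect_const_bundle]
  have hrev := (le_aspeRev (A := A) (p := p) (δ := δ) fun i U => (hδ2 i U).trans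
    (sum_le_sum fun t _ => mul_le_mul_of_nonneg_left (Set.indicator_le_indicator_of_subset
      (fun t (ht : _ ≤ _) => ht.trans (surplus_le_utility U)) (fun _ => zero_le_one) t)
      (A.fType_nonneg i t))).trans (A.aspeRev_le_aPostEnRev p δ)
  have hpoint : ∀ t : (∀ i j, T i j), 1 / 4 * ∑ j, (W j - p j) - 1 / 2 * ∑ i, τ i
      ≤ ∑ i, (δ i (remaining (A.aspeTake p δ t) i) : ℝ) / 2
      + (∑ j, (p j : ℝ) - ∑ j ∈ remaining (A.aspeTake p δ t) n, (p j : ℝ)) := by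
    intro t
    set R := remaining (A.aspeTake p δ t) n
    have hfees : 1 / 4 * ∑ j ∈ R, (W j - p j) - 1 / 2 * ∑ i, τ i
        ≤ ∑ i, (δ i (remaining (A.aspeTake p δ t) i) : ℝ) / 2 := by
      refine (sub_le_sub_right (mul_le_mul_of_nonneg_left (hsurplus R) (by norm_num)) _).trans ?_
      rw [mul_sum, mul_sum, ← sum_sub_distrib]
      refine sum_le_sum fun i _ => ?_
      have h1 : ∑ s, A.fType i s * A.surplus p (τ i) i s R
          ≤ ∑ s, A.fType i s * A.surplus p (τ i) i s (remaining (A.aspeTake p δ t) i) :=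
        sum_le_sum fun s _ => mul_le_mul_of_nonneg_left
          (surplus_mono (remaining_antitone _ i.2.le)) (A.fType_nonneg i s)
      linarith [hmean i (remaining (A.aspeTake p δ t) i)]
    have hsold : 1 / 4 * ∑ j ∈ univ \ R, (W j - p j) ≤ ∑ j ∈ univ \ R, (p j : ℝ) := by
      rw [mul_sum]
      refine sum_le_sum fun j _ => ?_
      have : (0 : ℝ) ≤ p j := (p j).coe_nonneg
      linarith [hWp j]
    have e1 := sum_sdiff (subset_univ R) (f := fun j => W j - (p j : ℝ))
    have e2 := sum_sdiff (subset_univ R) (f := fun j => (p j : ℝ))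
    linarith
  have hfin : 1 / 4 * ∑ j, (W j - p j) - 1 / 2 * ∑ i, τ i ≤ A.aPostEnRev := by
    refine le_trans ?_ hrev
    refine le_trans (le_of_eq ?_) (sum_le_sum fun t _ =>
      mul_le_mul_of_nonneg_left (hpoint t) (A.fProfile_nonneg t))
    rw [← sum_mul, A.sum_fProfile, one_mul]
  linarith

end Auction

/-! ### Supporting prices -/

/-- Supporting prices of a monotone function may be taken nonnegative. -/
lemma IsSupporting.max_zero {m : ℕ} {α : ℝ} {w : Finset (Fin m) → ℝ} {S : Finset (Fin m)}
    {θ : Fin m → ℝ} (h : IsSupporting α w S θ) (hw : ∀ S S', S ⊆ S' → w S ≤ w S') :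
    IsSupporting α w S fun j => max (θ j) 0 := by
  refine ⟨fun S' hS' => ?_, h.2.trans (sum_le_sum fun j _ => le_max_left _ _)⟩
  have : ∑ j ∈ S', max (θ j) 0 = ∑ j ∈ S' with 0 ≤ θ j, θ j := by
    rw [sum_filter]
    refine sum_congr rfl fun j _ => ?_
    split_ifs with hj
    exacts [max_eq_left hj, max_eq_right (not_le.1 hj).le]
  rw [this]
  exact (h.1 _ ((filter_subset _ _).trans hS')).trans (hw _ _ (filter_subset _ _))

namespace Auction

variable {n m : ℕ} {T : Fin n → Fin m → Type u} [∀ i j, Fintype (T i j)] {A : Auction n m T}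

/-- Subadditivity makes the value of the empty bundle nonnegative, supporting prices make it
nonpositive. -/
lemma SubadditiveOverIndependentItems.empty_eq_zero (hA : A.SubadditiveOverIndependentItems)
    {α : ℝ} (hα : 1 ≤ α) (hsupp : ∀ (i : Fin n) (ti : ∀ j, T i j) (S : Finset (Fin m)),
      ∃ θ : Fin m → ℝ, IsSupporting α (A.v i ti) S θ) (i : Fin n) (t : ∀ j, T i j) :
    A.v i t ∅ = 0 := by
  obtain ⟨θ, h1, h2⟩ := hsupp i t ∅
  have h3 := hA.subadditive i t ∅ ∅
  rw [union_empty] at h3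
  rw [sum_empty, div_le_iff₀ (by linarith), zero_mul] at h2
  linarith

/-! ### The shares of the items in the core -/

/-- The supporting prices of the core part of a bundle split at least the fraction `1 / α` of its
value among its items: `γ i t S j` is the share of item `j` when buyer `i` gets `S`. -/
lemma exists_coreShares (hA : A.SubadditiveOverIndependentItems) {α : ℝ} (hα : 1 ≤ α)
    (hsupp : ∀ (i : Fin n) (ti : ∀ j, T i j) (S : Finset (Fin m)),
      ∃ θ : Fin m → ℝ, IsSupporting α (A.v i ti) S θ) (β : Fin n → Fin m → ℝ)
    (hβc : ∀ i j, 0 ≤ β i j + A.c β i) :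
    ∃ γ : ∀ i, (∀ j, T i j) → Finset (Fin m) → Fin m → ℝ,
      (∀ i t S j, 0 ≤ γ i t S j) ∧ (∀ i t S, ∀ j ∉ S, γ i t S j = 0) ∧
      (∀ i t S S', ∑ j ∈ S', γ i t S j ≤ A.v i t S') ∧
      (∀ i t S j, γ i t S j ≤ β i j + A.c β i) ∧
      ∀ i t S, A.v i t (S ∩ A.coreItems β i t) ≤ α * ∑ j, γ i t S j := by
  choose θ hθ using hsupp
  set C := fun i t (S : Finset (Fin m)) => S ∩ A.coreItems β i t with hC
  have hpos := fun i t S => (hθ i t S).max_zero (hA.monotone i t)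
  have hv : ∀ i t S S', (∑ j ∈ S', if j ∈ C i t S then max (θ i t (C i t S) j) 0 else 0)
      ≤ A.v i t S' := by
    intro i t S S'
    rw [sum_ite_mem]
    exact ((hpos i t (C i t S)).1 _ inter_subset_right).trans
      (hA.monotone _ _ _ _ inter_subset_left)
  refine ⟨fun i t S j => if j ∈ C i t S then max (θ i t (C i t S) j) 0 else 0,
    fun i t S j => ?_, fun i t S j hj => ?_, hv, fun i t S j => ?_, fun i t S => ?_⟩
  · dsimp only
    split_ifs
    exacts [le_max_right _ _, le_rfl]
  · exact if_neg fun h => hj (mem_inter.1 h).1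
  · by_cases hj : j ∈ C i t S
    · have h1 := hv i t S {j}
      rw [sum_singleton] at h1
      have h2 : A.V i t j < β i j + A.c β i := by
        have := (mem_inter.1 hj).2
        simpa [coreItems] using this
      exact h1.trans h2.le
    · simpa only [if_neg hj] using hβc i j
  · have := (hpos i t (C i t S)).2
    rw [sum_ite_mem, univ_inter]
    rw [div_le_iff₀ (by linarith)] at this
    rw [mul_comm]
    exact this

/-- The share of an item worth more than `θ` is at most `β_ij`, which is counted only if the item
is allocated, plus `c_i`, which is counted only if the item is worth more than `β_ij`. -/
lemma expect_share_le {M : AllocationRule n m T} {b : ℝ} (hb0 : 0 < b) (hb1 : b < 1)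
    {β q : Fin n → Fin m → ℝ} (hβ : M.ThresholdRequirement A b β q)
    {γ : ∀ i, (∀ j, T i j) → Finset (Fin m) → Fin m → ℝ}
    (γS : ∀ i t S, ∀ j ∉ S, γ i t S j = 0) (γv : ∀ i t S S', ∑ j ∈ S', γ i t S j ≤ A.v i t S')
    {c : Fin n → ℝ} (hc : ∀ i, 0 ≤ c i) (γc : ∀ i t S j, γ i t S j ≤ β i j + c i)
    (i : Fin n) (j : Fin m) (θ : ℝ) :
    M.expect A i (fun t S => if θ < A.V i t j then γ i t S j else 0)
      ≤ 1 / b * (β i j * min (q i j) (A.probGt i j θ)) + c i * min (q i j) (A.probGt i j θ) := by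
  have hV : ∀ t S, γ i t S j ≤ A.V i t j := fun t S => by simpa [V] using γv i t S {j}
  have hpt : ∀ t S, (if θ < A.V i t j then γ i t S j else 0)
      ≤ β i j * (if j ∈ S ∧ θ < A.V i t j then 1 else 0)
        + c i * (if max (β i j) θ < A.V i t j then 1 else 0) := by
    intro t S
    have hβ0 := hβ.nonneg i j
    have hci := hc i
    by_cases hj : j ∈ S
    · by_cases hθ : θ < A.V i t j
      · by_cases hlt : β i j < A.V i t j
        · simpa [hj, hθ, hlt] using γc i t S j
        · simpa [hj, hθ, hlt] using (hV t S).trans (not_lt.1 hlt)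
      · simp [hθ]
    · simp only [γS i t S j hj, ite_self, hj, false_and, if_false, mul_zero, zero_add]
      split_ifs <;> simp [hci]
  have h1 : M.expect A i (fun t S => if j ∈ S ∧ θ < A.V i t j then 1 else 0)
      ≤ min (q i j) (A.probGt i j θ) / b := by
    rw [le_div_iff₀ hb0]
    refine le_min ?_ ?_
    · rw [← le_div_iff₀ hb0]
      refine le_trans ?_ (hβ.alloc i j)
      rw [← AllocationRule.expect_ite_mem]
      refine AllocationRule.expect_mono fun t S => ?_
      by_cases hj : j ∈ S <;> simp only [hj, true_and, false_and, if_true, if_false, le_rfl]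
      split_ifs <;> norm_num
    · have : M.expect A i (fun t S => if j ∈ S ∧ θ < A.V i t j then 1 else 0)
          ≤ A.probGt i j θ := by
        rw [probGt, prob_eq_sum_mul, ← AllocationRule.expect_const_bundle (M := M)]
        refine AllocationRule.expect_mono fun t S => ?_
        by_cases hθ : θ < A.V i t j <;>
          simp only [hθ, and_true, and_false, if_true, if_false, le_rfl]
        split_ifs <;> norm_num
      nlinarith [A.probGt_nonneg i j θ]
  have h2 : M.expect A i (fun t _ => if max (β i j) θ < A.V i t j then 1 else 0)
      ≤ min (q i j) (A.probGt i j θ) := by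
    rw [AllocationRule.expect_const_bundle, ← prob_eq_sum_mul]
    exact le_min ((prob_mono fun t ht => (le_max_left _ _).trans_lt ht).trans (hβ.lower i j))
      (prob_mono fun t ht => (le_max_right _ _).trans_lt ht)
  refine (AllocationRule.expect_mono hpt).trans ?_
  rw [AllocationRule.expect_add, AllocationRule.expect_mul_left, AllocationRule.expect_mul_left]
  refine add_le_add ?_ (mul_le_mul_of_nonneg_left h2 (hc i))
  refine (mul_le_mul_of_nonneg_left h1 (hβ.nonneg i j)).trans (le_of_eq ?_)
  ring

end Auction

end

/-! ### Bounding the core by the revenues -/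

theorem mainTheorem2 {n m : ℕ} {T : Fin n → Fin m → Type u} [∀ i j, Fintype (T i j)]
    (A : Auction n m T) (hA : A.SubadditiveOverIndependentItems)
    (α : ℝ) (hα : 1 ≤ α)
    (hsupp : ∀ (i : Fin n) (ti : ∀ j, T i j) (S : Finset (Fin m)),
      ∃ θ : Fin m → ℝ, IsSupporting α (A.v i ti) S θ)
    (b : ℝ) (hb0 : 0 < b) (hb1 : b < 1)
    (M : AllocationRule n m T) (β q : Fin n → Fin m → ℝ)
    (hβ : M.ThresholdRequirement A b β q) :
    M.core A β ≤
      α * (4 / (b * (1 - b)) + 24 / (1 - b)) * A.postRev + 8 * α * A.aPostEnRev := by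
  have h0 := hA.empty_eq_zero hα hsupp
  have c0 : ∀ i, 0 ≤ A.c β i := fun i => by
    rw [Auction.c_eq_excess]
    exact (A.excess_spec i _ _).1
  have hc := Auction.mul_sum_c_le_postRev hA h0 hb1 hβ.nonneg hβ.lower hβ.others
  obtain ⟨γ, γ0, γS, γv, γc, γα⟩ := Auction.exists_coreShares hA hα hsupp β
    fun i j => add_nonneg (hβ.nonneg i j) (c0 i)
  -- `G j` is the expected share of item `j` in the core; the price of `j` is half of it
  set G : Fin m → ℝ := fun j => ∑ i, M.expect A i fun t S => γ i t S j with hG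
  have G0 : ∀ j, 0 ≤ G j := fun j => sum_nonneg fun i _ =>
    AllocationRule.expect_nonneg fun t S => γ0 i t S j
  have hcore : M.core A β ≤ α * ∑ j, G j := by
    have e : α * ∑ j, G j = ∑ i, M.expect A i fun t S => α * ∑ j, γ i t S j := by
      rw [hG, sum_comm]
      simp only [AllocationRule.expect_mul_left, AllocationRule.expect_sum, mul_sum]
    rw [e]
    exact sum_le_sum fun i _ => AllocationRule.expect_mono fun t S => γα i t S
  obtain ⟨p, hp⟩ : ∃ p : Fin m → ℝ≥0, ∀ j, (p j : ℝ) = G j / 2 :=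
    ⟨fun j => (G j / 2).toNNReal, fun j => Real.coe_toNNReal _ (by linarith [G0 j])⟩
  set τ : Fin n → ℝ := fun i => A.excess i (fun j => p j) (q i) with hτ
  have τ0 : ∀ i, 0 ≤ τ i := fun i => (A.excess_spec i _ _).1
  choose r r1 r2 r3 r4 _ using fun i => A.exists_rates i (fun j => p j) (q i)
  have q0 : ∀ i j, 0 ≤ q i j := fun i j => (A.probGt_nonneg i j _).trans (hβ.lower i j)
  have r0 : ∀ i j, 0 ≤ r i j := fun i j => (le_min (q0 i j) (A.probGt_nonneg _ _ _)).trans (r1 i j)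
  set X : ℝ := ∑ i, ∑ j, max (β i j) (p j + τ i) * r i j with hX
  have hXrev : (1 - b) / 2 * X ≤ A.postRev := by
    refine Auction.mul_sum_price_mul_le_postRev hA h0 hb1
      (fun i j => (hβ.nonneg i j).trans (le_max_left _ _))
      (fun i j => le_trans (le_min ?_ ?_) (r1 i j))
      (fun i j => (r2 i j).trans ?_) r3
      fun i j => (sum_le_sum fun k _ => (r2 k j).trans (min_le_left _ _)).trans (hβ.others i j)
    · exact (A.probGt_antitone i j (le_max_left _ _)).trans (hβ.lower i j)
    · exact A.probGt_antitone i j (le_max_right _ _)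
    · rcases max_choice (β i j) (p j + τ i) with e | e <;> rw [e]
      · exact (min_le_left _ _).trans (hβ.upper i j)
      · exact min_le_right _ _
  have hτX : ∑ i, τ i ≤ 2 * X := by
    rw [hX, mul_sum]
    refine sum_le_sum fun i _ => (r4 i).trans ?_
    rw [mul_sum]
    refine mul_le_mul_of_nonneg_left (sum_le_sum fun j _ => mul_le_mul_of_nonneg_right ?_ (r0 i j))
      (by norm_num)
    have : (0 : ℝ) ≤ p j := (p j).coe_nonneg
    exact le_max_of_le_right (by linarith)
  -- the part of the shares that is lost when only the cheap items are counted
  set D : Fin m → ℝ := fun j => ∑ i, M.expect A i fun t S =>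
    if p j + τ i < A.V i t j then γ i t S j else 0 with hD
  have hDX : ∑ j, D j ≤ 1 / b * X + 1 / 2 * ∑ i, A.c β i := by
    rw [hD, sum_comm, hX, mul_sum, mul_sum, ← sum_add_distrib]
    refine sum_le_sum fun i _ => ?_
    have h1 : ∑ j, A.c β i * r i j ≤ 1 / 2 * A.c β i := by
      rw [← mul_sum]
      nlinarith [mul_le_mul_of_nonneg_left (r3 i) (c0 i)]
    refine le_trans ?_ (add_le_add le_rfl h1)
    rw [mul_sum, ← sum_add_distrib]
    refine sum_le_sum fun j _ =>
      (Auction.expect_share_le hb0 hb1 hβ γS γv c0 γc i j (p j + τ i)).trans ?_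
    have h2 := r1 i j
    have h3 : β i j * min (q i j) (A.probGt i j (p j + τ i)) ≤ max (β i j) (p j + τ i) * r i j :=
      mul_le_mul (le_max_left _ _) h2 (le_min (q0 i j) (A.probGt_nonneg _ _ _))
        ((hβ.nonneg i j).trans (le_max_left _ _))
    exact add_le_add (mul_le_mul_of_nonneg_left h3 (by positivity))
      (mul_le_mul_of_nonneg_left h2 (c0 i))
  have hW : ∀ j, G j - D j = ∑ i, M.expect A i fun t S =>
      if j ∈ A.cheapItems p (τ i) i t then γ i t S j else 0 := by
    intro j
    rw [hG, hD, ← sum_sub_distrib]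
    refine sum_congr rfl fun i _ => ?_
    rw [← AllocationRule.expect_sub]
    congr 1
    funext t S
    by_cases h : A.V i t j ≤ p j + τ i
    · simp [Auction.cheapItems, h, h.not_gt]
    · simp [Auction.cheapItems, h, not_le.1 h]
  have D0 : ∀ j, 0 ≤ D j := fun j => sum_nonneg fun i _ =>
    AllocationRule.expect_nonneg fun t S => by
      split_ifs
      exacts [γ0 i t S j, le_rfl]
  have haspe := Auction.sum_sub_price_le_aPostEnRev hA h0 M p τ0 γS γv hW fun j => by
    rw [hp]
    linarith [D0 j]
  have hGsum : ∑ j, G j ≤ 8 * A.aPostEnRev + 4 * ∑ i, τ i + 2 * ∑ j, D j := by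
    have : ∑ j, (G j - D j - p j) = (∑ j, G j) / 2 - ∑ j, D j := by
      simp only [hp, sum_sub_distrib, ← sum_div]
      ring
    linarith
  have hpr := A.postRev_nonneg
  have hb : 0 < 1 - b := sub_pos.2 hb1
  have hX' : X ≤ 2 / (1 - b) * A.postRev := by
    rw [div_mul_eq_mul_div, le_div_iff₀ hb]
    linarith
  have hc' : ∑ i, A.c β i ≤ 4 / (1 - b) * A.postRev := by
    rw [div_mul_eq_mul_div, le_div_iff₀ hb]
    linarith
  have hbX : 1 / b * X ≤ 2 / (b * (1 - b)) * A.postRev := by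
    refine (mul_le_mul_of_nonneg_left hX' (by positivity)).trans (le_of_eq ?_)
    field_simp
  have hfinal : ∑ j, G j
      ≤ (4 / (b * (1 - b)) + 24 / (1 - b)) * A.postRev + 8 * A.aPostEnRev := by
    have e1 : 2 / (1 - b) * A.postRev = 2 * (A.postRev / (1 - b)) := by ring
    have e2 : 4 / (1 - b) * A.postRev = 4 * (A.postRev / (1 - b)) := by ring
    have e3 : 24 / (1 - b) * A.postRev = 24 * (A.postRev / (1 - b)) := by ring
    have e4 : 4 / (b * (1 - b)) * A.postRev = 2 * (2 / (b * (1 - b)) * A.postRev) := by ring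
    have e5 : 0 ≤ A.postRev / (1 - b) := div_nonneg hpr hb.le
    rw [add_mul, e3, e4]
    rw [e1] at hX'
    rw [e2] at hc'
    linarith
  calc M.core A β ≤ α * ∑ j, G j := hcore
    _ ≤ α * ((4 / (b * (1 - b)) + 24 / (1 - b)) * A.postRev + 8 * A.aPostEnRev) :=
        mul_le_mul_of_nonneg_left hfinal (by linarith)
    _ = _ := by ring
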